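/- **Theorem (Intermediate Value Theorem).** Let $\mathsf{IVT}:\subseteq \mathcal C[0,1]\rightrightarrows[0,1]$ be the partial multi-valued operation $\mathsf{IVT}(f):=\{x\in[0,1]: f(x)=0\}$ with $\mathrm{dom}(\mathsf{IVT}):=\{f\in\mathcal C[0,1]: f(0)\cdot f(1)<0\}$, and let interval choice $\mathsf C_{\mathsf I}:\subseteq\mathcal A_-[0,1]\rightrightarrows[0,1]$ be the operation $A\mapsto A$ with $\mathrm{dom}(\mathsf C_{\mathsf I}):=\{[a,b]:0\le a\le b\le 1\}$. Then $\mathsf{IVT}$ and $\mathsf C_{\mathsf I}$ are strongly Weihrauch equivalent: $$\mathsf{IVT}\;\equiv_{\mathrm{sW}}\;\mathsf C_{\mathsf I}.$$ Here the notions are as follows. * A representation of a set $X$ is a surjective partial map $\delta_X:\subseteq\mathbb N^{\mathbb N}\to X$; if $\delta_X(p)=x$, then $p$ is called a name of $x$. For represented spaces $X,Y$ and $f:\subseteq X\rightrightarrows Y$, a partial function $F:\subseteq\mathbb N^{\mathbb N}\to\mathbb N^{\mathbb N}$ is a realizer of $f$, written $F\vdash f$, if $\delta_Y F(p)\in f(\delta_X(p))$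 for all $p\in\mathrm{dom}(f\delta_X)$. Then $f\le_{\mathrm{sW}} g$ means that there are computable $H,K:\subseteq\mathbb N^{\mathbb N}\to\mathbb N^{\mathbb N}$ such that for every $G\vdash g$ there is an $F\vdash f$ with $F=HGK$; and $f\equiv_{\mathrm{sW}} g$ means $f\le_{\mathrm{sW}} g$ and $g\le_{\mathrm{sW}} f$. * A function $F:\subseteq\mathbb N^{\mathbb N}\to\mathbb N^{\mathbb N}$ is computable if some program with oracle $p$ computes $n\mapsto F(p)(n)$; its domain consists of those $p$ for which the program halts on all $n$. * $[0,1]$ and $\mathcal C[0,1]$ (with the maximum metric) carry their Cauchy representations with respect to standard numberings $\alpha$ of the rational points and of the rational polygons, respectively: $p$ is a name of $x$ if $\lim_i\alpha(p(i))=x$ and $d(\alpha(p(i)),\alpha(p(k)))\le 2^{-i}$ for all $i<k$. * $\mathcal A_-[0,1]$ is the set of closed subsets of $[0,1]$ represented by negative information: $p$ is a name of $A$ if $p$ enumerates (indices of) rational open balls in $[0,1]$, the empty ball being allowed, whose union is $[0,1]\setminus A$. -/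

import Mathlib

namespace Weihrauch

/-! ### Computable partial functions on Baire space -/

/-- Baire space `ℕ^ℕ`. -/
abbrev Baire : Type := ℕ → ℕ

/-- The partial recursive functionals `Φ(p, n)`, with an oracle `p ∈ ℕ^ℕ` and an input `n ∈ ℕ`:
the least class containing the basic functions and the oracle call `(p, n) ↦ p n`, and closed under
pairing, composition, primitive recursion and unbounded search. This is `Nat.RecursiveIn`, uniformly
in the oracle: one and the same program works for all `p`. -/
inductive RecFunctional : (Baire → ℕ →. ℕ) → Prop
  | zero : RecFunctional fun _ _ => Part.some 0
  | succ : RecFunctional fun _ n => Part.some (n + 1)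
  | left : RecFunctional fun _ n => Part.some n.unpair.1
  | right : RecFunctional fun _ n => Part.some n.unpair.2
  | oracle : RecFunctional fun p n => Part.some (p n)
  | pair {Φ Ψ : Baire → ℕ →. ℕ} (hΦ : RecFunctional Φ) (hΨ : RecFunctional Ψ) :
      RecFunctional fun p n => Nat.pair <$> Φ p n <*> Ψ p n
  | comp {Φ Ψ : Baire → ℕ →. ℕ} (hΦ : RecFunctional Φ) (hΨ : RecFunctional Ψ) :
      RecFunctional fun p n => Ψ p n >>= Φ p
  | prec {Φ Ψ : Baire → ℕ →. ℕ} (hΦ : RecFunctional Φ) (hΨ : RecFunctional Ψ) :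
      RecFunctional fun p m =>
        m.unpair.2.rec (Φ p m.unpair.1) fun y ih =>
          ih >>= fun i => Ψ p (Nat.pair m.unpair.1 (Nat.pair y i))
  | rfind {Φ : Baire → ℕ →. ℕ} (hΦ : RecFunctional Φ) :
      RecFunctional fun p a => Nat.rfind fun n => (fun m => decide (m = 0)) <$> Φ p (Nat.pair a n)

/-- A partial function `F :⊆ ℕ^ℕ → ℕ^ℕ` is computable if some oracle program, given the oracle `p`,
computes every entry `F(p)(n)`; the domain consists of those `p` for which all entries are
produced. -/
def IsComputable (F : Baire →. Baire) : Prop :=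
  ∃ Φ : Baire → ℕ →. ℕ, RecFunctional Φ ∧ ∀ p q : Baire, q ∈ F p ↔ ∀ n, q n ∈ Φ p n

/-! ### Represented spaces, multi-valued functions, strong Weihrauch reducibility -/

/-- A represented space: a set `X` with a partial surjection `δ :⊆ ℕ^ℕ → X`, given by its graph
(`IsName p x` means `δ p = x`). -/
class RepresentedSpace (X : Type*) where
  IsName : Baire → X → Prop
  unique : ∀ {p : Baire} {x y : X}, IsName p x → IsName p y → x = y
  surjective : ∀ x : X, ∃ p : Baire, IsName p x

/-- A partial multi-valued function `f :⊆ X ⇉ Y`: a domain, and for every point of the domain a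
non-empty set of values. -/
structure MultiFun (X Y : Type*) where
  dom : Set X
  val : X → Set Y
  nonempty : ∀ x ∈ dom, (val x).Nonempty

/-- `F` is a realizer of `f`: for every name `p` of a point `x` of the domain of `f`, `F p` is
defined and is a name of an element of `f x`. -/
def Realizes {X Y : Type*} [RepresentedSpace X] [RepresentedSpace Y]
    (F : Baire →. Baire) (f : MultiFun X Y) : Prop :=
  ∀ (p : Baire) (x : X), RepresentedSpace.IsName p x → x ∈ f.dom →
    ∃ q ∈ F p, ∃ y ∈ f.val x, RepresentedSpace.IsName q y

/-- Strong Weihrauch reducibility of sets of partial functions on Baire space: there are fixed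
computable `H`, `K` such that every `G ∈ 𝒢` yields an `F ∈ ℱ` with `F = H ∘ G ∘ K`. -/
def SetStrongReducible (ℱ 𝒢 : Set (Baire →. Baire)) : Prop :=
  ∃ H K : Baire →. Baire, IsComputable H ∧ IsComputable K ∧
    ∀ G ∈ 𝒢, ∃ F ∈ ℱ, F = H.comp (G.comp K)

/-- Strong Weihrauch reducibility `f ≤_sW g` of multi-valued functions on represented spaces. -/
def StrongReducible {X Y Z W : Type*} [RepresentedSpace X] [RepresentedSpace Y]
    [RepresentedSpace Z] [RepresentedSpace W] (f : MultiFun X Y) (g : MultiFun Z W) : Prop :=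
  SetStrongReducible {F | Realizes F f} {G | Realizes G g}

/-- Strong Weihrauch equivalence `f ≡_sW g`. -/
def StrongEquivalent {X Y Z W : Type*} [RepresentedSpace X] [RepresentedSpace Y]
    [RepresentedSpace Z] [RepresentedSpace W] (f : MultiFun X Y) (g : MultiFun Z W) : Prop :=
  StrongReducible f g ∧ StrongReducible g f

/-! ### The standard representations of separable metric spaces and of their closed subsets -/

/-- The numbering `⟨i, ⟨j, k⟩⟩ ↦ (i - j) / (k + 1)` of the rational numbers. -/
def ratNum (n : ℕ) : ℚ :=
  ((n.unpair.1 : ℚ) - (n.unpair.2.unpair.1 : ℚ)) / ((n.unpair.2.unpair.2 : ℚ) + 1)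

theorem ratNum_surjective : Function.Surjective ratNum := by
  intro q
  refine ⟨Nat.pair q.num.toNat (Nat.pair (-q.num).toNat (q.den - 1)), ?_⟩
  have h1 : ((q.num.toNat : ℚ) - ((-q.num).toNat : ℚ)) = q.num := by
    have h : ((q.num.toNat : ℤ) - ((-q.num).toNat : ℤ)) = q.num := by omega
    exact_mod_cast h
  have h2 : (((q.den - 1 : ℕ) : ℚ) + 1) = q.den := by
    have h : q.den - 1 + 1 = q.den := Nat.sub_add_cancel q.pos
    exact_mod_cast h
  simp only [ratNum, Nat.unpair_pair, h1, h2]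
  exact Rat.num_div_den q

/-- The Cauchy representation of a metric space `X` with a dense sequence `α`: a name of `x` is a
sequence `p` of indices such that `(α (p i))_i` converges to `x` and
`d(α (p i), α (p k)) ≤ 2⁻ⁱ` for all `i < k`. -/
@[reducible] def cauchyRep {X : Type*} [MetricSpace X] (α : ℕ → X) (hα : DenseRange α) :
    RepresentedSpace X where
  IsName p x := (∀ i k, i < k → dist (α (p i)) (α (p k)) ≤ (1 / 2 : ℝ) ^ i) ∧
    Filter.Tendsto (fun i => α (p i)) Filter.atTop (nhds x)
  unique h h' := tendsto_nhds_unique h.2 h'.2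
  surjective x := by
    have h : ∀ n : ℕ, ∃ m, dist x (α m) < (1 / 2 : ℝ) ^ (n + 1) := fun n =>
      hα.exists_dist_lt x (by positivity)
    choose p hp using h
    refine ⟨p, fun i k hik => ?_, ?_⟩
    · have h1 := dist_triangle_left (α (p i)) (α (p k)) x
      have h2 : (1 / 2 : ℝ) ^ (k + 1) ≤ (1 / 2 : ℝ) ^ (i + 1) :=
        pow_le_pow_of_le_one (by norm_num) (by norm_num) (by omega)
      have h3 : (1 / 2 : ℝ) ^ (i + 1) + (1 / 2 : ℝ) ^ (i + 1) = (1 / 2 : ℝ) ^ i := by ring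
      linarith [hp i, hp k]
    · rw [tendsto_iff_dist_tendsto_zero]
      refine squeeze_zero (fun _ => dist_nonneg) (g := fun n => (1 / 2 : ℝ) ^ n) (fun n => ?_)
        (tendsto_pow_atTop_nhds_zero_of_lt_one (by norm_num) (by norm_num))
      rw [dist_comm]
      exact (hp n).le.trans (pow_le_pow_of_le_one (by norm_num) (by norm_num) (by omega))

/-- The rational open ball with index `⟨i, j⟩`: centre `α i` and radius the `j`-th rational number
(the ball is empty if that number is not positive). -/
def ratBall {X : Type*} [MetricSpace X] (α : ℕ → X) (n : ℕ) : Set X :=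
  Metric.ball (α n.unpair.1) (ratNum n.unpair.2 : ℝ)

/-- The negative information representation `ψ₋` of the closed subsets of a metric space with a
dense sequence `α`: a name of `A` is an enumeration of rational open balls that exhaust the
complement of `A`. -/
@[reducible] def negativeRep {X : Type*} [MetricSpace X] (α : ℕ → X) (hα : DenseRange α) :
    RepresentedSpace (TopologicalSpace.Closeds X) where
  IsName p A := (A : Set X)ᶜ = ⋃ i, ratBall α (p i)
  unique {p A B} h h' := by
    apply SetLike.coe_injective
    exact compl_injective (h.trans h'.symm)
  surjective A := by
    classical
    have he : ratBall α (Nat.pair 0 0) = ∅ := by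
      rw [ratBall, Metric.ball_eq_empty]
      simp [ratNum]
    refine ⟨fun n => if ratBall α n ⊆ (A : Set X)ᶜ then n else Nat.pair 0 0, ?_⟩
    apply Set.Subset.antisymm
    · intro x hx
      obtain ⟨ε, hε, hb⟩ := Metric.isOpen_iff.1 A.isClosed.isOpen_compl x hx
      obtain ⟨r, hr0, hr⟩ := exists_rat_btwn (half_pos hε)
      obtain ⟨i, hi⟩ := hα.exists_dist_lt x hr0
      obtain ⟨j, rfl⟩ := ratNum_surjective r
      have hsub : ratBall α (Nat.pair i j) ⊆ (A : Set X)ᶜ := by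
        refine subset_trans ?_ hb
        intro y hy
        simp only [ratBall, Nat.unpair_pair, Metric.mem_ball] at hy
        rw [Metric.mem_ball]
        have := dist_triangle_right y x (α i)
        linarith
      refine Set.mem_iUnion.2 ⟨Nat.pair i j, ?_⟩
      simp only [if_pos hsub]
      simpa [ratBall] using hi
    · refine Set.iUnion_subset fun n => ?_
      dsimp only
      split_ifs with h
      · exact h
      · rw [he]
        exact Set.empty_subset _

/-! ### The spaces `[0,1]`, `𝒜₋[0,1]` and `𝒞[0,1]` -/

/-- The dense sequence of all rational numbers in `[0,1]` (a rational number outside `[0,1]` is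
replaced by the nearest endpoint). -/
noncomputable def unitNum (n : ℕ) : unitInterval :=
  Set.projIcc 0 1 zero_le_one (ratNum n : ℝ)

theorem unitNum_dense : DenseRange unitNum := by
  have h1 : DenseRange fun n => (ratNum n : ℝ) :=
    Rat.denseRange_cast.comp ratNum_surjective.denseRange Rat.continuous_coe_real
  exact (Set.projIcc_surjective zero_le_one).denseRange.comp h1 continuous_projIcc

noncomputable instance unitIntervalRep : RepresentedSpace unitInterval :=
  cauchyRep unitNum unitNum_dense

noncomputable instance closedsRep : RepresentedSpace (TopologicalSpace.Closeds unitInterval) :=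
  negativeRep unitNum unitNum_dense

/-- The polygon on `[0,1]` that has the value `y i` at the node `i / (m + 1)`, for
`i = 0, …, m + 1`, and is affine between consecutive nodes. -/
noncomputable def polygon (m : ℕ) (y : ℕ → ℝ) : C(unitInterval, ℝ) where
  toFun x := ∑ i ∈ Finset.range (m + 2), y i * max 0 (1 - |((m : ℝ) + 1) * (x : ℝ) - i|)
  continuous_toFun := by fun_prop

/-- The numbering of all rational polygons on `[0,1]`: the index `⟨m, c⟩` stands for the
polygon with nodes `i / (m + 1)` whose values at the nodes are the rational numbers with indices
`l₀, l₁, …`, where `l` is the finite sequence with code `c` (continued by `0`). -/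
noncomputable def polygonNum (n : ℕ) : C(unitInterval, ℝ) :=
  polygon n.unpair.1 fun i =>
    (ratNum ((Denumerable.ofNat (List ℕ) n.unpair.2).getD i 0) : ℝ)

theorem hat_sum (m : ℕ) (t : ℝ) (h0 : 0 ≤ t) (h1 : t ≤ m + 1) :
    ∑ i ∈ Finset.range (m + 2), max 0 (1 - |t - i|) = 1 := by
  induction m with
  | zero =>
    have h1' : t ≤ 1 := by simpa using h1
    rw [Finset.sum_range_succ, Finset.sum_range_succ, Finset.sum_range_zero]
    push_cast
    rw [sub_zero, abs_of_nonneg h0, abs_of_nonpos (by linarith), max_eq_right (by linarith),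
      max_eq_right (by linarith)]
    ring
  | succ m ih =>
    rw [Finset.sum_range_succ]
    push_cast at h1 ⊢
    rcases le_total t (m + 1) with h | h
    · rw [ih h, abs_of_nonpos (by linarith), max_eq_left (by linarith), add_zero]
    · rw [Finset.sum_range_succ, Finset.sum_eq_zero]
      · push_cast
        rw [abs_of_nonneg (by linarith), abs_of_nonpos (by linarith), max_eq_right (by linarith),
          max_eq_right (by linarith)]
        ring
      · intro i hi
        have hi' : (i : ℝ) ≤ m := by
          exact_mod_cast Nat.lt_succ_iff.1 (Finset.mem_range.1 hi)
        rw [abs_of_nonneg (by linarith), max_eq_left (by linarith)]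

theorem node_dist (m i : ℕ) (x : ℝ) (h : |((m : ℝ) + 1) * x - i| ≤ 1) :
    |x - (i : ℝ) / (m + 1)| ≤ 1 / ((m : ℝ) + 1) := by
  have hm0 : (0 : ℝ) < m + 1 := by positivity
  have he : x - (i : ℝ) / (m + 1) = (((m : ℝ) + 1) * x - i) / (m + 1) := by
    field_simp
  rw [he, abs_div, abs_of_pos hm0]
  gcongr

theorem polygonNum_dense : DenseRange polygonNum := by
  refine Metric.denseRange_iff.2 fun f ε hε => ?_
  have huc : UniformContinuous f := CompactSpace.uniformContinuous_of_continuous f.continuous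
  obtain ⟨δ, hδ, hf⟩ := Metric.uniformContinuous_iff.1 huc (ε / 4) (by linarith)
  obtain ⟨m, hm⟩ := exists_nat_one_div_lt hδ
  have hnode : ∀ i : ℕ, ∃ c : ℕ,
      |f (Set.projIcc 0 1 zero_le_one ((i : ℝ) / (m + 1))) - (ratNum c : ℝ)| < ε / 4 := by
    intro i
    obtain ⟨q, hq⟩ := Rat.denseRange_cast.exists_dist_lt
      (f (Set.projIcc 0 1 zero_le_one ((i : ℝ) / (m + 1)))) (show 0 < ε / 4 by linarith)
    obtain ⟨c, rfl⟩ := ratNum_surjective q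
    exact ⟨c, hq⟩
  choose c hc using hnode
  refine ⟨Nat.pair m (Encodable.encode ((List.range (m + 2)).map c)), ?_⟩
  refine lt_of_le_of_lt ((ContinuousMap.dist_le (show 0 ≤ ε / 2 by linarith)).2 fun x => ?_)
    (show ε / 2 < ε by linarith)
  have hm0 : (0 : ℝ) < m + 1 := by positivity
  have hx0 : (0 : ℝ) ≤ (m + 1) * x := mul_nonneg hm0.le x.2.1
  have hx1 : ((m : ℝ) + 1) * x ≤ m + 1 := by nlinarith [x.2.2]
  have hs := hat_sum m _ hx0 hx1
  have hval : polygonNum (Nat.pair m (Encodable.encode ((List.range (m + 2)).map c))) x =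
      ∑ i ∈ Finset.range (m + 2),
        (ratNum (c i) : ℝ) * max 0 (1 - |((m : ℝ) + 1) * (x : ℝ) - i|) := by
    simp only [polygonNum, polygon, Nat.unpair_pair, Denumerable.ofNat_encode,
      ContinuousMap.coe_mk]
    refine Finset.sum_congr rfl fun i hi => ?_
    have hi' := Finset.mem_range.1 hi
    simp [List.getD, hi']
  have hfx : f x = ∑ i ∈ Finset.range (m + 2),
      f x * max 0 (1 - |((m : ℝ) + 1) * (x : ℝ) - i|) := by
    rw [← Finset.mul_sum, hs, mul_one]
  rw [hval, hfx, Real.dist_eq, ← Finset.sum_sub_distrib]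
  refine (Finset.abs_sum_le_sum_abs _ _).trans ?_
  have hε2 : ε / 2 = ∑ i ∈ Finset.range (m + 2),
      ε / 2 * max 0 (1 - |((m : ℝ) + 1) * (x : ℝ) - i|) := by
    rw [← Finset.mul_sum, hs, mul_one]
  rw [hε2]
  refine Finset.sum_le_sum fun i hi => ?_
  rw [← sub_mul, abs_mul, abs_of_nonneg (le_max_left (0 : ℝ) (1 - |((m : ℝ) + 1) * (x : ℝ) - i|))]
  rcases le_total (1 : ℝ) |((m : ℝ) + 1) * (x : ℝ) - i| with h | h
  · rw [max_eq_left (by linarith), mul_zero, mul_zero]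
  · refine mul_le_mul_of_nonneg_right ?_ (le_max_left _ _)
    have hi' : (i : ℝ) ≤ m + 1 := by
      exact_mod_cast Nat.lt_succ_iff.1 (Finset.mem_range.1 hi)
    have hmem : (i : ℝ) / (m + 1) ∈ Set.Icc (0 : ℝ) 1 :=
      ⟨by positivity, (div_le_one hm0).2 hi'⟩
    have hd : dist x (Set.projIcc 0 1 zero_le_one ((i : ℝ) / (m + 1))) < δ := by
      rw [Set.projIcc_of_mem zero_le_one hmem, Subtype.dist_eq, Real.dist_eq]
      exact (node_dist m i x h).trans_lt hm
    have h2 := hf hd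
    rw [Real.dist_eq] at h2
    have h3 := abs_sub_le (f x) (f (Set.projIcc 0 1 zero_le_one ((i : ℝ) / (m + 1))))
      (ratNum (c i) : ℝ)
    linarith [hc i]

noncomputable instance continuousRep : RepresentedSpace C(unitInterval, ℝ) :=
  cauchyRep polygonNum polygonNum_dense

/-! ### The two operations -/

/-- The Intermediate Value Theorem as a multi-valued operation: `f ↦ {x ∈ [0,1] : f x = 0}`,
defined for the continuous `f` on `[0,1]` with `f 0 * f 1 < 0`. -/
def IVT : MultiFun C(unitInterval, ℝ) unitInterval where
  dom := {f | f 0 * f 1 < 0}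
  val f := {x | f x = 0}
  nonempty f hf := by
    rcases mul_neg_iff.1 (show f 0 * f 1 < 0 from hf) with ⟨h0, h1⟩ | ⟨h0, h1⟩
    · exact mem_range_of_exists_le_of_exists_ge f.continuous ⟨1, h1.le⟩ ⟨0, h0.le⟩
    · exact mem_range_of_exists_le_of_exists_ge f.continuous ⟨0, h0.le⟩ ⟨1, h1.le⟩

/-- Interval choice `C_I`: given a non-empty closed interval `[a,b] ⊆ [0,1]` by negative
information, find one of its points. -/
def intervalChoice : MultiFun (TopologicalSpace.Closeds unitInterval) unitInterval where
  dom := {A | ∃ a b : unitInterval, a ≤ b ∧ (A : Set unitInterval) = Set.Icc a b}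
  val A := (A : Set unitInterval)
  nonempty := by
    rintro A ⟨a, b, hab, hA⟩
    rw [hA]
    exact Set.nonempty_Icc.2 hab

end Weihrauch

/-! `IVT` reduces to interval choice by a search for sign changes. Starting from 0 and 1, all pairs
of a rational `c` and a precision `k` are tested. If `c` lies strictly between the current endpoints
and the `k`-th polygon of the name certifies that `f c` has the sign of `f 0` (or of `f 1`), then
`c` replaces the left (or right) endpoint. The endpoints converge to some `a ≤ b`. If `a < b`, a
rational in between with a nonzero value would have become an endpoint, so `f` vanishes on `[a, b]`
by continuity. If `a = b`, then in the limit `f a` has weakly the sign of both `f 0` and `f 1`, so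
it is 0 (`exists_zero_interval`). The discarded outer parts enumerate the complement of `[a, b]`,
and every point of `[a, b]` is a zero, so the answer needs no postprocessing.

Conversely, negative information on `[a, b]` yields rationals `t s` increasing to `a` and `u s`
decreasing to `b` (`absorb_limits`). The series `∑ 2⁻ˢ deadZone (t s) (u s)` is negative left of
`a`, zero on `[a, b]` and positive right of `b`. Precomposition with `x ↦ 3 x - 1` makes the signs
at 0 and 1 strict even if `a = 0` or `b = 1`, and the same affine map, clamped, sends a zero back
into `[a, b]`. Uniform Lipschitz and tail bounds give a name of this function
(`exists_totalRec_sign_change`).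

Both preprocessing maps are total: they iterate a primitive recursive step whose only access to the
oracle is one reading per step (`TotalRec.iterate`). -/

namespace Weihrauch

open Encodable Filter Topology

/-! ### Total computable functionals with values in a `Primcodable` type -/

/-- A total functional `ℕ^ℕ × ℕ → σ` that is computed by an oracle program. -/
def TotalRec {σ : Type*} [Primcodable σ] (f : Baire → ℕ → σ) : Prop :=
  RecFunctional fun p n => Part.some (encode (f p n))

theorem RecFunctional.of_eq {Φ Ψ : Baire → ℕ →. ℕ} (hΦ : RecFunctional Φ)
    (h : ∀ p n, Φ p n = Ψ p n) : RecFunctional Ψ :=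
  (funext fun p => funext fun n => h p n : Φ = Ψ) ▸ hΦ

theorem RecFunctional.of_natPrimrec {f : ℕ → ℕ} (hf : Nat.Primrec f) :
    RecFunctional fun _ n => Part.some (f n) := by
  induction hf with
  | zero => exact RecFunctional.zero
  | succ => exact RecFunctional.succ
  | left => exact RecFunctional.left
  | right => exact RecFunctional.right
  | pair _ _ hf hg =>
    convert RecFunctional.pair hf hg using 3
    simp [Seq.seq]
  | comp _ _ hf hg =>
    convert RecFunctional.comp hf hg using 3
    simp
  | @prec f g _ _ hf hg =>
    refine (RecFunctional.prec hf hg).of_eq fun p n => ?_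
    simp only [Nat.unpaired]
    induction n.unpair.2 with
    | zero => rfl
    | succ k ih => dsimp only; rw [ih]; simp

namespace TotalRec

variable {σ τ ρ : Type*} [Primcodable σ] [Primcodable τ] [Primcodable ρ]

theorem of_primrec {f : ℕ → σ} (hf : Primrec f) : TotalRec fun _ n => f n :=
  RecFunctional.of_natPrimrec (Primrec.nat_iff.1 (Primrec.encode.comp hf))

theorem comp {f : Baire → ℕ → σ} {g : Baire → ℕ → ℕ} (hf : TotalRec f) (hg : TotalRec g) :
    TotalRec fun p n => f p (g p n) := by
  unfold TotalRec at *
  convert RecFunctional.comp hf hg using 3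
  simp

theorem primrec_comp {f : Baire → ℕ → σ} {g : σ → τ} (hg : Primrec g) (hf : TotalRec f) :
    TotalRec fun p n => g (f p n) := by
  -- The code of `some x` is the successor of the code of `x`; `pred` removes this shift.
  have h : Nat.Primrec fun n => (encode ((decode (α := σ) n).map g)).pred :=
    Primrec.nat_iff.1 (Primrec.pred.comp (Primrec.encode.comp
      (Primrec.option_map Primrec.decode (hg.comp Primrec.snd).to₂)))
  unfold TotalRec at *
  convert RecFunctional.comp (RecFunctional.of_natPrimrec h) hf using 3
  simp

theorem pair {f : Baire → ℕ → σ} {g : Baire → ℕ → τ} (hf : TotalRec f) (hg : TotalRec g) :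
    TotalRec fun p n => (f p n, g p n) := by
  unfold TotalRec at *
  convert RecFunctional.pair hf hg using 3
  simp [Seq.seq]

theorem oracle : TotalRec fun p n => p n :=
  RecFunctional.oracle

/-- The oracle enters only through the reading `r p k`, so a step is an oracle-free primitive
recursive map of the reading and the state. Both searches below, as well as `listMap`, are
instances. -/
theorem iterate {r : Baire → ℕ → ρ} {g : ρ → σ → σ} (s : σ) (hr : TotalRec r) (hg : Primrec₂ g) :
    TotalRec fun p n => (Nat.rec s (fun k x => g (r p k) x) n : σ) := by
  -- Here `m` codes a dummy parameter, the step number and the code of the state. The default `s` is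
  -- never reached, since the state always decodes.
  have hstep : TotalRec fun p m =>
      ((decode (α := σ) m.unpair.2.unpair.2).map (g (r p m.unpair.2.unpair.1))).getD s := by
    have h1 : Primrec fun m : ℕ => m.unpair.2 := Primrec.snd.comp Primrec.unpair
    have h2 : Primrec fun m : ℕ => m.unpair.1 := Primrec.fst.comp Primrec.unpair
    exact primrec_comp
      (g := fun y : ρ × ℕ => ((decode (α := σ) y.2).map (g y.1)).getD s)
      (Primrec.option_getD.comp (Primrec.option_map (Primrec.decode.comp Primrec.snd)
        (hg.comp (Primrec.fst.comp Primrec.fst) Primrec.snd).to₂) (Primrec.const s))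
      ((hr.comp (of_primrec (h2.comp h1))).pair (of_primrec (h1.comp h1)))
  have h := RecFunctional.prec (of_primrec (Primrec.const s)) hstep
  have h' := RecFunctional.comp h (RecFunctional.pair RecFunctional.zero
    (RecFunctional.of_natPrimrec (Primrec.nat_iff.1 Primrec.id)))
  refine h'.of_eq fun p n => ?_
  simp only [Seq.seq, Part.map_eq_map, Part.map_some, Part.bind_eq_bind, Part.bind_some,
    Nat.unpair_pair, id]
  induction n with
  | zero => rfl
  | succ k ih => simp [ih]

/-- The list of the first `n` values of a computable functional is computable. -/
theorem listMap {f : Baire → ℕ → σ} (hf : TotalRec f) :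
    TotalRec fun p n => (List.range n).map (f p) := by
  have h := iterate (g := fun x l => l ++ [x]) [] hf
    (Primrec.list_concat.comp Primrec.snd Primrec.fst).to₂
  refine RecFunctional.of_eq h fun p n => ?_
  congr 2
  induction n with
  | zero => rfl
  | succ k ih => simp [List.range_succ, ih]

theorem isComputable {f : Baire → ℕ → ℕ} (hf : TotalRec f) :
    IsComputable fun p => Part.some (f p) := by
  refine ⟨_, hf, fun p q => ?_⟩
  simp [funext_iff]

end TotalRec

/-! ### Primitive recursive functions with rational values -/

/-- A function with rational values that is primitive recursive with respect to the numbering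
`ratNum`. -/
def RatPrimrec {α : Type*} [Primcodable α] (f : α → ℚ) : Prop :=
  ∃ g : α → ℕ, Primrec g ∧ ∀ a, ratNum (g a) = f a

theorem primrec_unpair_fst : Primrec fun n : ℕ => n.unpair.1 := Primrec.fst.comp Primrec.unpair

theorem primrec_unpair_snd : Primrec fun n : ℕ => n.unpair.2 := Primrec.snd.comp Primrec.unpair

theorem primrec_two_pow : Primrec fun n : ℕ => 2 ^ n :=
  (Primrec₂.unpaired'.1 Nat.Primrec.pow).comp (Primrec.const 2) Primrec.id

namespace RatPrimrec

variable {α β : Type*} [Primcodable α] [Primcodable β]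

theorem of_eq {f g : α → ℚ} (hf : RatPrimrec f) (h : ∀ a, f a = g a) : RatPrimrec g :=
  (funext h : f = g) ▸ hf

theorem ratNum {f : α → ℕ} (hf : Primrec f) : RatPrimrec fun a => ratNum (f a) :=
  ⟨f, hf, fun _ => rfl⟩

theorem const (q : ℚ) : RatPrimrec fun _ : α => q :=
  ⟨fun _ => (ratNum_surjective q).choose, Primrec.const _,
    fun _ => (ratNum_surjective q).choose_spec⟩

theorem comp {f : β → ℚ} {g : α → β} (hf : RatPrimrec f) (hg : Primrec g) :
    RatPrimrec fun a => f (g a) := by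
  obtain ⟨u, hu, hu'⟩ := hf
  exact ⟨_, hu.comp hg, fun a => hu' _⟩

theorem frac {i j k : α → ℕ} (hi : Primrec i) (hj : Primrec j) (hk : Primrec k) :
    RatPrimrec fun a => ((i a : ℚ) - j a) / ((k a : ℚ) + 1) :=
  ⟨fun a => Nat.pair (i a) (Nat.pair (j a) (k a)),
    Primrec₂.natPair.comp hi (Primrec₂.natPair.comp hj hk), fun a => by simp [Weihrauch.ratNum]⟩

theorem natCast {f : α → ℕ} (hf : Primrec f) : RatPrimrec fun a => (f a : ℚ) :=
  (frac hf (Primrec.const 0) (Primrec.const 0)).of_eq fun a => by simp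

theorem half_pow {f : α → ℕ} (hf : Primrec f) : RatPrimrec fun a => (1 / 2 : ℚ) ^ f a :=
  (frac (Primrec.const 1) (Primrec.const 0)
    (Primrec.nat_sub.comp (primrec_two_pow.comp hf) (Primrec.const 1))).of_eq fun a => by
      have : 1 ≤ 2 ^ f a := Nat.one_le_two_pow
      push_cast [Nat.cast_sub this]
      simp

/-- The numerators and the denominator of a primitive recursive function with rational values. -/
theorem exists_frac {f : α → ℚ} (hf : RatPrimrec f) : ∃ i j k : α → ℕ, Primrec i ∧ Primrec j ∧
    Primrec k ∧ ∀ a, f a = ((i a : ℚ) - j a) / ((k a : ℚ) + 1) := by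
  obtain ⟨g, hg, h⟩ := hf
  exact ⟨_, _, _, primrec_unpair_fst.comp hg,
    primrec_unpair_fst.comp (primrec_unpair_snd.comp hg),
    primrec_unpair_snd.comp (primrec_unpair_snd.comp hg), fun a => (h a).symm⟩

theorem add {f g : α → ℚ} (hf : RatPrimrec f) (hg : RatPrimrec g) :
    RatPrimrec fun a => f a + g a := by
  obtain ⟨i, j, k, hi, hj, hk, h⟩ := hf.exists_frac
  obtain ⟨i', j', k', hi', hj', hk', h'⟩ := hg.exists_frac
  have s := Primrec.succ.comp hk
  have s' := Primrec.succ.comp hk'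
  refine (frac
    (Primrec.nat_add.comp (Primrec.nat_mul.comp hi s') (Primrec.nat_mul.comp hi' s))
    (Primrec.nat_add.comp (Primrec.nat_mul.comp hj s') (Primrec.nat_mul.comp hj' s))
    (Primrec.nat_sub.comp (Primrec.nat_mul.comp s s') (Primrec.const 1))).of_eq fun a => ?_
  have : 1 ≤ (k a).succ * (k' a).succ := Nat.succ_le_of_lt (by positivity)
  rw [h, h']
  push_cast [Nat.cast_sub this]
  field_simp
  ring

theorem neg {f : α → ℚ} (hf : RatPrimrec f) : RatPrimrec fun a => -f a := by
  obtain ⟨i, j, k, hi, hj, hk, h⟩ := hf.exists_frac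
  exact (frac hj hi hk).of_eq fun a => by rw [h]; ring

theorem sub {f g : α → ℚ} (hf : RatPrimrec f) (hg : RatPrimrec g) :
    RatPrimrec fun a => f a - g a :=
  (hf.add hg.neg).of_eq fun a => by ring

theorem mul {f g : α → ℚ} (hf : RatPrimrec f) (hg : RatPrimrec g) :
    RatPrimrec fun a => f a * g a := by
  obtain ⟨i, j, k, hi, hj, hk, h⟩ := hf.exists_frac
  obtain ⟨i', j', k', hi', hj', hk', h'⟩ := hg.exists_frac
  have s := Primrec.succ.comp hk
  have s' := Primrec.succ.comp hk'
  refine (frac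
    (Primrec.nat_add.comp (Primrec.nat_mul.comp hi hi') (Primrec.nat_mul.comp hj hj'))
    (Primrec.nat_add.comp (Primrec.nat_mul.comp hi hj') (Primrec.nat_mul.comp hj hi'))
    (Primrec.nat_sub.comp (Primrec.nat_mul.comp s s') (Primrec.const 1))).of_eq fun a => ?_
  have : 1 ≤ (k a).succ * (k' a).succ := Nat.succ_le_of_lt (by positivity)
  rw [h, h']
  push_cast [Nat.cast_sub this]
  field_simp
  ring

/-- Clearing the positive denominators and moving the subtracted terms across leaves a comparison of
natural numbers. -/
theorem primrecPred_lt {f g : α → ℚ} (hf : RatPrimrec f) (hg : RatPrimrec g) :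
    PrimrecPred fun a => f a < g a := by
  obtain ⟨i, j, k, hi, hj, hk, h⟩ := hf.exists_frac
  obtain ⟨i', j', k', hi', hj', hk', h'⟩ := hg.exists_frac
  have s := Primrec.succ.comp hk
  have s' := Primrec.succ.comp hk'
  refine (Primrec.nat_lt.comp
    (Primrec.nat_add.comp (Primrec.nat_mul.comp hi s') (Primrec.nat_mul.comp hj' s))
    (Primrec.nat_add.comp (Primrec.nat_mul.comp hi' s) (Primrec.nat_mul.comp hj s'))).of_eq
    fun a => ?_
  rw [h, h', div_lt_div_iff₀ (by positivity) (by positivity), ← Nat.cast_lt (α := ℚ)]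
  push_cast
  constructor <;> intro h <;> linarith

theorem ite {c : α → Prop} [DecidablePred c] {f g : α → ℚ} (hc : PrimrecPred c)
    (hf : RatPrimrec f) (hg : RatPrimrec g) : RatPrimrec fun a => if c a then f a else g a := by
  obtain ⟨u, hu, hu'⟩ := hf
  obtain ⟨v, hv, hv'⟩ := hg
  refine ⟨_, Primrec.ite hc hu hv, fun a => ?_⟩
  dsimp only
  split_ifs <;> simp [hu', hv']

theorem max {f g : α → ℚ} (hf : RatPrimrec f) (hg : RatPrimrec g) :
    RatPrimrec fun a => max (f a) (g a) :=
  (ite (hf.primrecPred_lt hg) hg hf).of_eq fun a => by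
    split_ifs with h
    · exact (max_eq_right h.le).symm
    · exact (max_eq_left (not_lt.1 h)).symm

theorem min {f g : α → ℚ} (hf : RatPrimrec f) (hg : RatPrimrec g) :
    RatPrimrec fun a => min (f a) (g a) :=
  (hf.neg.max hg.neg).neg.of_eq fun a => by rw [max_neg_neg, neg_neg]

theorem abs {f : α → ℚ} (hf : RatPrimrec f) : RatPrimrec fun a => |f a| :=
  hf.max hf.neg

/-- The recursion runs on indices: `g` turns an index of a partial sum into an index of the next
one. -/
theorem sum_range {n : α → ℕ} {f : α → ℕ → ℚ} (hn : Primrec n)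
    (hf : RatPrimrec fun x : α × ℕ => f x.1 x.2) :
    RatPrimrec fun a => ∑ i ∈ Finset.range (n a), f a i := by
  obtain ⟨g, hg, hg'⟩ : RatPrimrec fun x : α × ℕ × ℕ => Weihrauch.ratNum x.2.2 + f x.1 x.2.1 :=
    (RatPrimrec.ratNum (Primrec.snd.comp Primrec.snd)).add
      (hf.comp (Primrec.pair Primrec.fst (Primrec.fst.comp Primrec.snd)))
  obtain ⟨z, hz⟩ := ratNum_surjective 0
  refine ⟨_, Primrec.nat_rec' (h := fun a y => g (a, y)) hn (Primrec.const z)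
    (hg.comp (Primrec.pair Primrec.fst Primrec.snd)).to₂, fun a => ?_⟩
  dsimp only
  induction n a with
  | zero => simpa using hz
  | succ k ih => rw [Finset.sum_range_succ, ← ih]; exact hg' _

end RatPrimrec
/-! ### Interval choice computes zeros -/

/-- One step of the search for a sign change: the two components are the current endpoints `a < b`,
and a test point `c` between them replaces the endpoint at which the function is known to have the
same sign. -/
noncomputable def trisect (c : ℚ) (T₀ T₁ : Prop) (z : ℚ × ℚ) : ℚ × ℚ :=
  open Classical in
  if z.1 < c ∧ c < z.2 then if T₀ then (c, z.2) else if T₁ then (z.1, c) else z else z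

theorem trisect_bound (c : ℚ) (T₀ T₁ : Prop) (z : ℚ × ℚ) :
    z.1 ≤ (trisect c T₀ T₁ z).1 ∧ (trisect c T₀ T₁ z).2 ≤ z.2 := by
  rw [trisect]
  split_ifs with h h' h''
  · exact ⟨h.1.le, le_rfl⟩
  · exact ⟨le_rfl, h.2.le⟩
  · exact ⟨le_rfl, le_rfl⟩
  · exact ⟨le_rfl, le_rfl⟩

theorem trisect_lt (c : ℚ) (T₀ T₁ : Prop) {z : ℚ × ℚ} (hz : z.1 < z.2) :
    (trisect c T₀ T₁ z).1 < (trisect c T₀ T₁ z).2 := by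
  rw [trisect]
  split_ifs with h h' h''
  exacts [h.2, h.1, hz, hz]

/-! ### Convergence of the search for a sign change -/

section Analysis

variable {g : ℝ → ℝ} {T₀ T₁ : ℕ → ℚ → Prop} {z : ℕ → ℚ × ℚ}

theorem trisect_bounds (h0 : z 0 = (0, 1))
    (hz : ∀ s, z (s + 1) = trisect (ratNum s.unpair.1) (T₀ s.unpair.2 (ratNum s.unpair.1))
      (T₁ s.unpair.2 (ratNum s.unpair.1)) (z s)) (s : ℕ) :
    0 ≤ (z s).1 ∧ (z s).1 < (z s).2 ∧ (z s).2 ≤ 1 ∧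
      (z s).1 ≤ (z (s + 1)).1 ∧ (z (s + 1)).2 ≤ (z s).2 := by
  rw [hz]
  refine ⟨?_, ?_, ?_, trisect_bound _ _ _ _⟩
  · induction s with
    | zero => simp [h0]
    | succ s ih => exact ih.trans (hz s ▸ (trisect_bound _ _ _ _).1)
  · induction s with
    | zero => simp [h0]
    | succ s ih => exact hz s ▸ trisect_lt _ _ _ ih
  · induction s with
    | zero => simp [h0]
    | succ s ih => exact le_trans (hz s ▸ (trisect_bound _ _ _ _).2) ih

/-- The invariant behind the case `a = b`. Soundness of the tests suffices, because accepted points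
lie in `[0, 1]` by `trisect_bounds`. -/
theorem trisect_sign (g0 : 0 < g 0 * g 0) (g1 : 0 < g 1 * g 1)
    (hT₀ : ∀ k c, 0 ≤ c → c ≤ 1 → T₀ k c → 0 < g 0 * g c)
    (hT₁ : ∀ k c, 0 ≤ c → c ≤ 1 → T₁ k c → 0 < g 1 * g c) (h0 : z 0 = (0, 1))
    (hz : ∀ s, z (s + 1) = trisect (ratNum s.unpair.1) (T₀ s.unpair.2 (ratNum s.unpair.1))
      (T₁ s.unpair.2 (ratNum s.unpair.1)) (z s)) (s : ℕ) :
    0 < g 0 * g (z s).1 ∧ 0 < g 1 * g (z s).2 := by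
  induction s with
  | zero => simpa only [h0, Rat.cast_zero, Rat.cast_one] using ⟨g0, g1⟩
  | succ s ih =>
    obtain ⟨h1, h2, h3, -, -⟩ := trisect_bounds h0 hz s
    rw [hz, trisect]
    split_ifs with h h' h''
    · exact ⟨hT₀ _ _ (h1.trans h.1.le) (h.2.le.trans h3) h', ih.2⟩
    · exact ⟨ih.1, hT₁ _ _ (h1.trans h.1.le) (h.2.le.trans h3) h''⟩
    · exact ih
    · exact ih

/-- The endpoints of the search for a sign change converge to the endpoints of an interval on which
the function vanishes. -/
theorem exists_zero_interval (hg : Continuous g) (hs : g 0 * g 1 < 0)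
    (hT₀ : ∀ k c, 0 ≤ c → c ≤ 1 → T₀ k c → 0 < g 0 * g c)
    (hT₁ : ∀ k c, 0 ≤ c → c ≤ 1 → T₁ k c → 0 < g 1 * g c)
    (hT₀' : ∀ c : ℚ, 0 ≤ c → c ≤ 1 → 0 < g 0 * g c → ∃ k, T₀ k c)
    (hT₁' : ∀ c : ℚ, 0 ≤ c → c ≤ 1 → 0 < g 1 * g c → ∃ k, T₁ k c) (h0 : z 0 = (0, 1))
    (hz : ∀ s, z (s + 1) = trisect (ratNum s.unpair.1) (T₀ s.unpair.2 (ratNum s.unpair.1))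
      (T₁ s.unpair.2 (ratNum s.unpair.1)) (z s)) :
    ∃ a b : ℝ, 0 ≤ a ∧ a ≤ b ∧ b ≤ 1 ∧ (∀ x, x < a ↔ ∃ s, x < (z s).1) ∧
      (∀ x, b < x ↔ ∃ s, ((z s).2 : ℝ) < x) ∧ ∀ x, a ≤ x → x ≤ b → g x = 0 := by
  have hb := trisect_bounds h0 hz
  have hg0 : g 0 ≠ 0 := fun h => by simp [h] at hs
  have hg1 : g 1 ≠ 0 := fun h => by simp [h] at hs
  have hsign := trisect_sign (mul_self_pos.2 hg0) (mul_self_pos.2 hg1) hT₀ hT₁ h0 hz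
  have hmono : Monotone fun s => ((z s).1 : ℝ) :=
    monotone_nat_of_le_succ fun s => by exact_mod_cast (hb s).2.2.2.1
  have hanti : Antitone fun s => ((z s).2 : ℝ) :=
    antitone_nat_of_succ_le fun s => by exact_mod_cast (hb s).2.2.2.2
  have hlt : ∀ s t, ((z s).1 : ℝ) ≤ (z t).2 := fun s t =>
    (hmono (le_max_left s t)).trans
      (le_trans (Rat.cast_le.2 (hb (max s t)).2.1.le) (hanti (le_max_right s t)))
  have hA : BddAbove (Set.range fun s => ((z s).1 : ℝ)) :=
    ⟨(z 0).2, by rintro _ ⟨s, rfl⟩; exact hlt s 0⟩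
  have hB : BddBelow (Set.range fun s => ((z s).2 : ℝ)) :=
    ⟨(z 0).1, by rintro _ ⟨s, rfl⟩; exact hlt 0 s⟩
  set a : ℝ := ⨆ s, ((z s).1 : ℝ) with ha
  set b : ℝ := ⨅ s, ((z s).2 : ℝ) with hb'
  have hza : ∀ s, ((z s).1 : ℝ) ≤ a := le_ciSup hA
  have hzb : ∀ s, b ≤ ((z s).2 : ℝ) := ciInf_le hB
  have hab : a ≤ b := ciSup_le fun s => le_ciInf fun t => hlt s t
  have ha0 : 0 ≤ a := by simpa [h0] using hza 0
  have hb1 : b ≤ 1 := by simpa [h0] using hzb 0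
  refine ⟨a, b, ha0, hab, hb1, fun x => lt_ciSup_iff hA, fun x => ciInf_lt_iff hB, ?_⟩
  -- A rational `c` in `(a, b)` stays strictly between the endpoints forever, so step `⟨n, k⟩` does
  -- test it at precision `k`. Success would make `c` an endpoint; hence all tests fail, and by
  -- completeness `g c` has the sign of neither `g 0` nor `g 1`.
  have hrat : ∀ c : ℚ, a < c → (c : ℝ) < b → g c = 0 := by
    intro c hac hcb
    by_contra hc
    have hc0 : 0 ≤ c := by exact_mod_cast ha0.trans hac.le
    have hc1 : c ≤ 1 := by exact_mod_cast hcb.le.trans hb1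
    have hsc : ∀ s, (z s).1 < c ∧ c < (z s).2 := fun s =>
      ⟨by exact_mod_cast (hza s).trans_lt hac, by exact_mod_cast hcb.trans_le (hzb s)⟩
    obtain ⟨n, hn⟩ := ratNum_surjective c
    have hstep : ∀ k, ¬ T₀ k c ∧ ¬ T₁ k c := by
      intro k
      have h := hz (Nat.pair n k)
      have h' := hsc (Nat.pair n k + 1)
      rw [h, Nat.unpair_pair, trisect] at h'
      simp only [hn] at h'
      rw [if_pos (hsc _)] at h'
      split_ifs at h' with h1 h2
      · exact absurd h'.1 (lt_irrefl _)
      · exact absurd h'.2 (lt_irrefl _)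
      · exact ⟨fun h => h1 (hn ▸ h), fun h => h2 (hn ▸ h)⟩
    have hn0 : ¬ 0 < g 0 * g c := fun h => (hT₀' c hc0 hc1 h).elim fun k hk => (hstep k).1 hk
    have hn1 : ¬ 0 < g 1 * g c := fun h => (hT₁' c hc0 hc1 h).elim fun k hk => (hstep k).2 hk
    have : 0 < g c * g c := mul_self_pos.2 hc
    -- The product of the two nonpositive numbers is `g 0 * g 1 * (g c)²`, which is negative.
    nlinarith [mul_nonneg (neg_nonneg.2 (not_lt.1 hn0)) (neg_nonneg.2 (not_lt.1 hn1))]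
  have hIoo : ∀ x ∈ Set.Ioo a b, g x = 0 := by
    intro x hx
    by_contra hne
    have hopen : IsOpen (Set.Ioo a b ∩ {y | g y ≠ 0}) :=
      isOpen_Ioo.inter (isOpen_ne_fun hg continuous_const)
    obtain ⟨_, hy, c, rfl⟩ := Rat.denseRange_cast.inter_open_nonempty _ hopen ⟨x, hx, hne⟩
    exact hy.2 (hrat c hy.1.1 hy.1.2)
  intro x hax hxb
  rcases hab.lt_or_eq with h | h
  · have hcl : Set.Icc a b ⊆ {y | g y = 0} := by
      rw [← closure_Ioo h.ne]
      exact closure_minimal hIoo (isClosed_eq hg continuous_const)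
    exact hcl ⟨hax, hxb⟩
  -- The interval is one point: density gives nothing, and the sign invariant is passed to the limit
  -- along both endpoint sequences.
  · have hxa : x = a := le_antisymm (hxb.trans h.ge) hax
    rw [hxa]
    have h1 : 0 ≤ g 0 * g a := ge_of_tendsto
      ((hg.tendsto _).comp (tendsto_atTop_ciSup hmono hA) |>.const_mul (g 0))
      (Eventually.of_forall fun s => (hsign s).1.le)
    have h2 : 0 ≤ g 1 * g a := by
      rw [h]
      exact ge_of_tendsto
        ((hg.tendsto _).comp (tendsto_atTop_ciInf hanti hB) |>.const_mul (g 1))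
        (Eventually.of_forall fun s => (hsign s).2.le)
    by_contra hne
    have : 0 < g a * g a := mul_self_pos.2 hne
    nlinarith [mul_nonneg h1 h2]

end Analysis
-- Certifying signs at rational points from a name of the function
/-- The value of the rational polygon with index `n` at a rational number. -/
def polyVal (n : ℕ) (c : ℚ) : ℚ :=
  ∑ i ∈ Finset.range (n.unpair.1 + 2), ratNum ((Denumerable.ofNat (List ℕ) n.unpair.2).getD i 0) *
    max 0 (1 - |((n.unpair.1 : ℚ) + 1) * c - i|)

theorem polygonNum_apply (n : ℕ) (x : unitInterval) (c : ℚ) (hx : (x : ℝ) = c) :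
    polygonNum n x = polyVal n c := by
  simp only [polygonNum, polygon, polyVal, ContinuousMap.coe_mk, hx]
  push_cast
  rfl

theorem primrec_ofNat_list : Primrec (Denumerable.ofNat (List ℕ)) := by
  refine ((Primrec.option_getD.comp Primrec.decode (Primrec.const [])) :
    Primrec fun n : ℕ => ((decode n : Option (List ℕ)).getD [])).of_eq fun n => ?_
  rw [Denumerable.decode_eq_ofNat, Option.getD_some]

theorem RatPrimrec.polyVal {α : Type*} [Primcodable α] {n : α → ℕ} {c : α → ℚ} (hn : Primrec n)
    (hc : RatPrimrec c) : RatPrimrec fun a => polyVal (n a) (c a) := by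
  have hm : Primrec fun a => (n a).unpair.1 := primrec_unpair_fst.comp hn
  have hl : Primrec fun a => Denumerable.ofNat (List ℕ) (n a).unpair.2 :=
    primrec_ofNat_list.comp (primrec_unpair_snd.comp hn)
  refine sum_range (Primrec.nat_add.comp hm (Primrec.const 2)) (mul (ratNum ?_)
    ((const 0).max ((const 1).sub ((((natCast hm).add (const 1)).mul hc).comp Primrec.fst |>.sub
      (natCast Primrec.snd)).abs)))
  exact (Primrec.list_getD 0).comp (hl.comp Primrec.fst) Primrec.snd

/-- The polygon with index `n` has values of the same sign at `c` and `d`, of absolute value greater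
than `2⁻ᵏ`. -/
def SameSign (n k : ℕ) (c d : ℚ) : Prop :=
  ((1 / 2) ^ k < polyVal n c ∧ (1 / 2) ^ k < polyVal n d) ∨
    (polyVal n c < -(1 / 2) ^ k ∧ polyVal n d < -(1 / 2) ^ k)

theorem primrecPred_sameSign {α : Type*} [Primcodable α] {n k : α → ℕ} {c d : α → ℚ}
    (hn : Primrec n) (hk : Primrec k) (hc : RatPrimrec c) (hd : RatPrimrec d) :
    PrimrecPred fun a => SameSign (n a) (k a) (c a) (d a) := by
  have hk' := RatPrimrec.half_pow hk
  have hc' := RatPrimrec.polyVal hn hc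
  have hd' := RatPrimrec.polyVal hn hd
  exact ((hk'.primrecPred_lt hc').and (hk'.primrecPred_lt hd')).or
    ((hc'.primrecPred_lt hk'.neg).and (hd'.primrecPred_lt hk'.neg))

theorem dist_le_of_isName {X : Type*} [MetricSpace X] {α : ℕ → X} {p : Baire} {x : X}
    (h : ∀ i k, i < k → dist (α (p i)) (α (p k)) ≤ (1 / 2 : ℝ) ^ i)
    (h' : Tendsto (fun i => α (p i)) atTop (𝓝 x)) (i : ℕ) :
    dist (α (p i)) x ≤ (1 / 2 : ℝ) ^ i :=
  le_of_tendsto (tendsto_const_nhds.dist h')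
    ((eventually_gt_atTop i).mono fun k hk => h i k hk)

theorem abs_polyVal_sub_le {p : Baire} {f : C(unitInterval, ℝ)}
    (hp : RepresentedSpace.IsName p f) (k : ℕ) {c : ℚ} (h0 : 0 ≤ c) (h1 : c ≤ 1) :
    |(polyVal (p k) c : ℝ) - Set.IccExtend zero_le_one f c| ≤ (1 / 2 : ℝ) ^ k := by
  have hc : (c : ℝ) ∈ Set.Icc (0 : ℝ) 1 := ⟨by exact_mod_cast h0, by exact_mod_cast h1⟩
  rw [Set.IccExtend_of_mem _ _ hc, ← polygonNum_apply (p k) ⟨c, hc⟩ c rfl, ← Real.dist_eq]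
  exact (ContinuousMap.dist_apply_le_dist _).trans (dist_le_of_isName hp.1 hp.2 k)

/-- Soundness of the test: the `k`-th polygon is within `2⁻ᵏ` of `f`, so a value beyond `2⁻ᵏ` in
absolute value has the sign of `f`. -/
theorem mul_pos_of_sameSign {p : Baire} {f : C(unitInterval, ℝ)}
    (hp : RepresentedSpace.IsName p f) {k : ℕ} {c d : ℚ} (hc0 : 0 ≤ c) (hc1 : c ≤ 1) (hd0 : 0 ≤ d)
    (hd1 : d ≤ 1) (h : SameSign (p k) k c d) :
    0 < Set.IccExtend zero_le_one f c * Set.IccExtend zero_le_one f d := by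
  have hc := abs_le.1 (abs_polyVal_sub_le hp k hc0 hc1)
  have hd := abs_le.1 (abs_polyVal_sub_le hp k hd0 hd1)
  rcases h with ⟨h, h'⟩ | ⟨h, h'⟩
  · have h := (Rat.cast_lt (K := ℝ)).2 h
    have h' := (Rat.cast_lt (K := ℝ)).2 h'
    push_cast at h h'
    exact mul_pos (by linarith) (by linarith)
  · have h := (Rat.cast_lt (K := ℝ)).2 h
    have h' := (Rat.cast_lt (K := ℝ)).2 h'
    push_cast at h h'
    exact mul_pos_of_neg_of_neg (by linarith) (by linarith)

/-- Completeness of the test: nonzero values are detected once the precision is fine enough. -/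
theorem exists_sameSign {p : Baire} {f : C(unitInterval, ℝ)}
    (hp : RepresentedSpace.IsName p f) {c d : ℚ} (hc0 : 0 ≤ c) (hc1 : c ≤ 1) (hd0 : 0 ≤ d)
    (hd1 : d ≤ 1) (h : 0 < Set.IccExtend zero_le_one f c * Set.IccExtend zero_le_one f d) :
    ∃ k, SameSign (p k) k c d := by
  set u := Set.IccExtend zero_le_one f c
  set v := Set.IccExtend zero_le_one f d
  have hu : u ≠ 0 := left_ne_zero_of_mul h.ne'
  have hv : v ≠ 0 := right_ne_zero_of_mul h.ne'
  have hm : 0 < min |u| |v| := lt_min (abs_pos.2 hu) (abs_pos.2 hv)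
  -- Half of the minimum: one `2⁻ᵏ` is lost to the approximation and another is needed to pass the
  -- threshold.
  obtain ⟨k, hk⟩ := exists_pow_lt_of_lt_one (half_pos hm) (show (1 / 2 : ℝ) < 1 by norm_num)
  have hku := hk.trans_le (div_le_div_of_nonneg_right (min_le_left |u| |v|) zero_le_two)
  have hkv := hk.trans_le (div_le_div_of_nonneg_right (min_le_right |u| |v|) zero_le_two)
  have hc := abs_le.1 (abs_polyVal_sub_le hp k hc0 hc1)
  have hd := abs_le.1 (abs_polyVal_sub_le hp k hd0 hd1)
  refine ⟨k, ?_⟩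
  rcases pos_and_pos_or_neg_and_neg_of_mul_pos h with ⟨h1, h2⟩ | ⟨h1, h2⟩
  · rw [abs_of_pos h1] at hku
    rw [abs_of_pos h2] at hkv
    refine Or.inl ⟨?_, ?_⟩ <;> rw [← Rat.cast_lt (K := ℝ)] <;> push_cast <;> linarith
  · rw [abs_of_neg h1] at hku
    rw [abs_of_neg h2] at hkv
    refine Or.inr ⟨?_, ?_⟩ <;> rw [← Rat.cast_lt (K := ℝ)] <;> push_cast <;> linarith

/-! ### The search on indices and the enumeration of the complement -/

/-- One step of the search for a sign change, on indices of rational numbers; `x.1` is the number of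
the step, and `x.2` is the index of a polygon. -/
noncomputable def trisectIdx (x z : ℕ × ℕ) : ℕ × ℕ :=
  open Classical in
  if ratNum z.1 < ratNum x.1.unpair.1 ∧ ratNum x.1.unpair.1 < ratNum z.2 then
    if SameSign x.2 x.1.unpair.2 0 (ratNum x.1.unpair.1) then (x.1.unpair.1, z.2)
    else if SameSign x.2 x.1.unpair.2 1 (ratNum x.1.unpair.1) then (z.1, x.1.unpair.1) else z
  else z

theorem map_trisectIdx (x z : ℕ × ℕ) : Prod.map ratNum ratNum (trisectIdx x z) =
    trisect (ratNum x.1.unpair.1) (SameSign x.2 x.1.unpair.2 0 (ratNum x.1.unpair.1))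
      (SameSign x.2 x.1.unpair.2 1 (ratNum x.1.unpair.1)) (Prod.map ratNum ratNum z) := by
  simp only [trisectIdx, trisect, Prod.map_fst, Prod.map_snd]
  split_ifs <;> rfl

theorem primrec_trisectIdx : Primrec₂ trisectIdx := by
  classical
  have hx : Primrec fun y : (ℕ × ℕ) × (ℕ × ℕ) => y.1.1 := Primrec.fst.comp Primrec.fst
  have hn : Primrec fun y : (ℕ × ℕ) × (ℕ × ℕ) => y.1.2 := Primrec.snd.comp Primrec.fst
  have hc := primrec_unpair_fst.comp hx
  have hk := primrec_unpair_snd.comp hx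
  have ha : Primrec fun y : (ℕ × ℕ) × (ℕ × ℕ) => y.2.1 := Primrec.fst.comp Primrec.snd
  have hb : Primrec fun y : (ℕ × ℕ) × (ℕ × ℕ) => y.2.2 := Primrec.snd.comp Primrec.snd
  have hc' := RatPrimrec.ratNum hc
  exact Primrec.ite (((RatPrimrec.ratNum ha).primrecPred_lt hc').and
      (hc'.primrecPred_lt (RatPrimrec.ratNum hb)))
    (Primrec.ite (primrecPred_sameSign hn hk (RatPrimrec.const 0) hc') (hc.pair hb)
      (Primrec.ite (primrecPred_sameSign hn hk (RatPrimrec.const 1) hc') (ha.pair hc)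
        Primrec.snd)) Primrec.snd

/-- An index of a rational number. -/
noncomputable def ratIdx (q : ℚ) : ℕ := (ratNum_surjective q).choose

@[simp]
theorem ratNum_ratIdx (q : ℚ) : ratNum (ratIdx q) = q := (ratNum_surjective q).choose_spec

/-- The indices of the endpoints in the search for a sign change of the function named by `p`. -/
noncomputable def zeroBounds (p : Baire) (n : ℕ) : ℕ × ℕ :=
  Nat.rec (ratIdx 0, ratIdx 1) (fun s z => trisectIdx (s, p s.unpair.2) z) n

theorem zeroBounds_zero (p : Baire) : zeroBounds p 0 = (ratIdx 0, ratIdx 1) := rfl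

theorem zeroBounds_succ (p : Baire) (s : ℕ) :
    zeroBounds p (s + 1) = trisectIdx (s, p s.unpair.2) (zeroBounds p s) := rfl

theorem totalRec_zeroBounds : TotalRec zeroBounds :=
  TotalRec.iterate (r := fun p s => (s, p s.unpair.2)) _
    ((TotalRec.of_primrec Primrec.id).pair
      (TotalRec.oracle.comp (TotalRec.of_primrec primrec_unpair_snd))) primrec_trisectIdx

/-- The balls `B(0, a)` and `B(1, 1 - b)` for the endpoints `a`, `b` in the search for a sign
change, as a function of the kind of ball and of the endpoints. -/
theorem exists_outerBall : ∃ g : ℕ × ℕ × ℕ → ℕ, Primrec g ∧ ∀ i a b,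
    ratBall unitNum (g (i, a, b)) =
      if i = 0 then {x : unitInterval | (x : ℝ) < ratNum a}
      else {x : unitInterval | (ratNum b : ℝ) < x} := by
  obtain ⟨u, hu, hu'⟩ : RatPrimrec fun b : ℕ => 1 - ratNum b :=
    (RatPrimrec.const 1).sub (RatPrimrec.ratNum Primrec.id)
  have hi : Primrec fun y : ℕ × ℕ × ℕ => y.1 := Primrec.fst
  have ha : Primrec fun y : ℕ × ℕ × ℕ => y.2.1 := Primrec.fst.comp Primrec.snd
  have hb : Primrec fun y : ℕ × ℕ × ℕ => y.2.2 := Primrec.snd.comp Primrec.snd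
  refine ⟨fun y => if y.1 = 0 then Nat.pair (ratIdx 0) y.2.1 else Nat.pair (ratIdx 1) (u y.2.2),
    Primrec.ite (Primrec.eq.comp hi (Primrec.const 0))
      (Primrec₂.natPair.comp (Primrec.const _) ha)
      (Primrec₂.natPair.comp (Primrec.const _) (hu.comp hb)), fun i a b => ?_⟩
  dsimp only
  split_ifs with h
  · ext x
    have hx := x.2.1
    simp only [ratBall, Nat.unpair_pair, unitNum, ratNum_ratIdx, Metric.mem_ball,
      Subtype.dist_eq, Real.dist_eq, Set.mem_ofPred_eq, Rat.cast_zero, Set.projIcc_left, sub_zero]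
    rw [abs_of_nonneg hx]
  · ext x
    have hx := x.2.2
    simp only [ratBall, Nat.unpair_pair, unitNum, ratNum_ratIdx, Metric.mem_ball, hu',
      Subtype.dist_eq, Real.dist_eq, Set.mem_ofPred_eq, Rat.cast_one, Set.projIcc_right]
    rw [abs_of_nonpos (by linarith)]
    push_cast
    constructor <;> intro h <;> linarith

theorem isName_closeds_iff {p : Baire} {A : TopologicalSpace.Closeds unitInterval} :
    RepresentedSpace.IsName p A ↔ (A : Set unitInterval)ᶜ = ⋃ i, ratBall unitNum (p i) :=
  Iff.rfl

/-- A name of a function with a sign change can be converted into a name of an interval on which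
the function vanishes. -/
theorem exists_totalRec_zero_interval : ∃ K : Baire → ℕ → ℕ, TotalRec K ∧
    ∀ (p : Baire) (f : C(unitInterval, ℝ)), RepresentedSpace.IsName p f → f 0 * f 1 < 0 →
      ∃ A ∈ intervalChoice.dom, RepresentedSpace.IsName (K p) A ∧ ∀ x ∈ A, f x = 0 := by
  obtain ⟨g, hg, hball⟩ := exists_outerBall
  -- Entry `⟨0, s⟩` is the left ball of stage `s`; entry `⟨i, s⟩` with `i ≠ 0` is the right one.
  refine ⟨fun p n => g (n.unpair.1, zeroBounds p n.unpair.2),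
    TotalRec.primrec_comp hg ((TotalRec.of_primrec primrec_unpair_fst).pair
      (totalRec_zeroBounds.comp (TotalRec.of_primrec primrec_unpair_snd))), fun p f hp hf => ?_⟩
  -- The function is extended to the real line by its boundary values, so that the search can be
  -- analysed over `ℝ`.
  obtain ⟨a, b, ha, hab, hb, hlt, hgt, hzero⟩ := exists_zero_interval
    (g := Set.IccExtend zero_le_one f) (T₀ := fun k c => SameSign (p k) k 0 c)
    (T₁ := fun k c => SameSign (p k) k 1 c)
    (z := fun s => Prod.map ratNum ratNum (zeroBounds p s))
    f.continuous.Icc_extend'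
    (by simpa using hf)
    (fun k c h0 h1 h => by
      simpa using mul_pos_of_sameSign hp le_rfl zero_le_one h0 h1 h)
    (fun k c h0 h1 h => by
      simpa using mul_pos_of_sameSign hp zero_le_one le_rfl h0 h1 h)
    (fun c h0 h1 h => exists_sameSign hp le_rfl zero_le_one h0 h1 (by simpa using h))
    (fun c h0 h1 h => exists_sameSign hp zero_le_one le_rfl h0 h1 (by simpa using h))
    (by simp [zeroBounds_zero])
    (fun s => by rw [zeroBounds_succ, map_trisectIdx])
  let a' : unitInterval := ⟨a, ha, hab.trans hb⟩
  let b' : unitInterval := ⟨b, ha.trans hab, hb⟩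
  refine ⟨⟨Set.Icc a' b', isClosed_Icc⟩, ⟨a', b', hab, rfl⟩, ?_, fun x hx => ?_⟩
  · rw [isName_closeds_iff, TopologicalSpace.Closeds.coe_mk]
    ext x
    have hx : x ∈ (Set.Icc a' b')ᶜ ↔ (x : ℝ) < a ∨ b < x := by
      simp only [Set.mem_compl_iff, Set.mem_Icc, not_and_or, not_le]
      rfl
    rw [hx, hlt, hgt, Set.mem_iUnion]
    constructor
    · rintro (⟨s, hs⟩ | ⟨s, hs⟩)
      · refine ⟨Nat.pair 0 s, ?_⟩
        rw [hball]
        simpa using hs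
      · refine ⟨Nat.pair 1 s, ?_⟩
        rw [hball]
        simpa using hs
    · rintro ⟨n, hn⟩
      rw [hball] at hn
      split_ifs at hn
      · exact Or.inl ⟨_, hn⟩
      · exact Or.inr ⟨_, hn⟩
  · have := hzero x hx.1 hx.2
    rwa [Set.IccExtend_val] at this

theorem isComputable_some : IsComputable fun p => Part.some p :=
  TotalRec.isComputable TotalRec.oracle

theorem ivt_strongReducible_intervalChoice : StrongReducible IVT intervalChoice := by
  obtain ⟨K, hK, hK'⟩ := exists_totalRec_zero_interval
  -- The outer map is the identity: the point chosen from the interval is already a zero.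
  refine ⟨_, _, isComputable_some, hK.isComputable, fun G hG => ⟨_, fun p f hp hf => ?_, rfl⟩⟩
  obtain ⟨A, hA, hname, hzero⟩ := hK' p f hp hf
  obtain ⟨q, hq, x, hx, hqx⟩ := hG _ A hname hA
  refine ⟨q, ?_, x, hzero x hx, hqx⟩
  exact Part.mem_bind (Part.mem_bind (Part.mem_some _) hq) (Part.mem_some q)

/-! ### Zeros compute interval choice -/

/-- The left endpoint of the rational open ball with index `n` (as a ball of the real line). -/
def leftEnd (n : ℕ) : ℚ := max 0 (min 1 (ratNum n.unpair.1)) - ratNum n.unpair.2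

/-- The right endpoint of the rational open ball with index `n` (as a ball of the real line). -/
def rightEnd (n : ℕ) : ℚ := max 0 (min 1 (ratNum n.unpair.1)) + ratNum n.unpair.2

theorem coe_unitNum (n : ℕ) : (unitNum n : ℝ) = ((max 0 (min 1 (ratNum n)) : ℚ) : ℝ) := by
  rw [unitNum, Set.coe_projIcc]
  push_cast
  rfl

/-- A ball of `[0, 1]` is the trace of a real interval with rational endpoints, so membership of a
rational point is decidable from indices. -/
theorem mem_ratBall_unitNum {n : ℕ} {x : unitInterval} :
    x ∈ ratBall unitNum n ↔ (leftEnd n : ℝ) < x ∧ (x : ℝ) < rightEnd n := by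
  rw [ratBall, Metric.mem_ball, Subtype.dist_eq, Real.dist_eq, coe_unitNum, abs_lt, leftEnd,
    rightEnd, Rat.cast_sub, Rat.cast_add]
  constructor <;> rintro ⟨h1, h2⟩ <;> constructor <;> linarith

theorem RatPrimrec.clamp : RatPrimrec fun n : ℕ => Max.max 0 (Min.min 1 (Weihrauch.ratNum n)) :=
  (const 0).max ((const 1).min (ratNum Primrec.id))

theorem ratPrimrec_leftEnd : RatPrimrec leftEnd :=
  (RatPrimrec.clamp.comp primrec_unpair_fst).sub (RatPrimrec.ratNum primrec_unpair_snd)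

theorem ratPrimrec_rightEnd : RatPrimrec rightEnd :=
  (RatPrimrec.clamp.comp primrec_unpair_fst).add (RatPrimrec.ratNum primrec_unpair_snd)

/-- If the ball with index `n` contains one of the two points `z.1`, `z.2`, then `z.1` is moved to
its right endpoint, respectively `z.2` to its left endpoint. -/
def absorb (n : ℕ) (z : ℚ × ℚ) : ℚ × ℚ :=
  (if leftEnd n < z.1 ∧ z.1 < rightEnd n then rightEnd n else z.1,
    if leftEnd n < z.2 ∧ z.2 < rightEnd n then leftEnd n else z.2)

theorem exists_primrec_absorb : ∃ g : ℕ → ℕ × ℕ → ℕ × ℕ, Primrec₂ g ∧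
    ∀ n z, Prod.map ratNum ratNum (g n z) = absorb n (Prod.map ratNum ratNum z) := by
  have hl : RatPrimrec fun y : ℕ × ℕ × ℕ => leftEnd y.1 := ratPrimrec_leftEnd.comp Primrec.fst
  have hr : RatPrimrec fun y : ℕ × ℕ × ℕ => rightEnd y.1 := ratPrimrec_rightEnd.comp Primrec.fst
  have h1 : RatPrimrec fun y : ℕ × ℕ × ℕ => ratNum y.2.1 :=
    RatPrimrec.ratNum (Primrec.fst.comp Primrec.snd)
  have h2 : RatPrimrec fun y : ℕ × ℕ × ℕ => ratNum y.2.2 :=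
    RatPrimrec.ratNum (Primrec.snd.comp Primrec.snd)
  obtain ⟨u, hu, hu'⟩ := RatPrimrec.ite ((hl.primrecPred_lt h1).and (h1.primrecPred_lt hr)) hr h1
  obtain ⟨v, hv, hv'⟩ := RatPrimrec.ite ((hl.primrecPred_lt h2).and (h2.primrecPred_lt hr)) hl h2
  exact ⟨fun n z => (u (n, z), v (n, z)), (hu.pair hv).to₂, fun n z => Prod.ext (hu' _) (hv' _)⟩

/-- The approximations from outside to the endpoints of the interval named by `p` are computable. -/
theorem exists_totalRec_absorb : ∃ z : Baire → ℕ → ℕ × ℕ, TotalRec z ∧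
    ∀ p, Prod.map ratNum ratNum (z p 0) = (0, 1) ∧
      ∀ s, Prod.map ratNum ratNum (z p (s + 1)) =
        absorb (p s.unpair.1) (Prod.map ratNum ratNum (z p s)) := by
  obtain ⟨g, hg, hg'⟩ := exists_primrec_absorb
  exact ⟨_, TotalRec.iterate (r := fun p s => p s.unpair.1) (ratIdx 0, ratIdx 1)
    (TotalRec.oracle.comp (TotalRec.of_primrec primrec_unpair_fst)) hg,
    fun p => ⟨by simp, fun s => hg' _ _⟩⟩

/-- A point that starts at `0` and is moved to the right endpoint of every interval in which it is
found converges to the left endpoint of the set that the intervals leave uncovered. -/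
theorem absorb_limit {l r : ℕ → ℚ} {a b : ℝ} (ha : 0 ≤ a) (hab : a ≤ b) (hb : b ≤ 1)
    (h : ∀ x : ℝ, 0 ≤ x → x ≤ 1 → ((∃ i, l i < x ∧ x < r i) ↔ x < a ∨ b < x)) {t : ℕ → ℚ}
    (h0 : t 0 = 0) (ht : ∀ s, t (s + 1) =
      if l s.unpair.1 < t s ∧ t s < r s.unpair.1 then r s.unpair.1 else t s) :
    (∀ s, 0 ≤ t s ∧ (t s : ℝ) ≤ a) ∧ ∀ x < a, ∃ s, x < t s := by
  have hmono : Monotone t := monotone_nat_of_le_succ fun s => by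
    rw [ht]
    split_ifs with h'
    exacts [h'.2.le, le_rfl]
  have hle : ∀ s, (t s : ℝ) ≤ a := by
    intro s
    induction s with
    | zero => simpa [h0] using ha
    | succ s ih =>
      rw [ht]
      split_ifs with h'
      -- A jump beyond `a` would give `l < t s ≤ a < r`, so `a` itself would be covered.
      · by_contra! hlt
        have hl : (l s.unpair.1 : ℝ) < t s := by exact_mod_cast h'.1
        rcases (h a ha (hab.trans hb)).1 ⟨_, hl.trans_le ih, hlt⟩ with h'' | h'' <;> linarith
      · exact ih
  refine ⟨fun s => ⟨h0 ▸ hmono s.zero_le, hle s⟩, fun x hx => ?_⟩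
  by_contra! hcon
  have hbdd : BddAbove (Set.range fun s => (t s : ℝ)) := ⟨a, by rintro _ ⟨s, rfl⟩; exact hle s⟩
  set τ : ℝ := ⨆ s, (t s : ℝ)
  have htτ : ∀ s, (t s : ℝ) ≤ τ := le_ciSup hbdd
  have hτa : τ < a := (ciSup_le hcon).trans_lt hx
  have hτ0 : 0 ≤ τ := by simpa [h0] using htτ 0
  -- If the supremum `τ` stayed below `a`, some interval `i` would cover it. Step `⟨i, s⟩` comes no
  -- earlier than step `s`, finds the point inside this interval and moves it to `r i > τ`.
  obtain ⟨i, hli, hri⟩ := (h τ hτ0 (by linarith)).2 (Or.inl hτa)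
  obtain ⟨s, hs⟩ := exists_lt_of_lt_ciSup hli
  have hs' : l i < t (Nat.pair i s) :=
    (Rat.cast_lt.1 hs).trans_le (hmono (Nat.right_le_pair i s))
  have hr' : t (Nat.pair i s) < r i := by exact_mod_cast (htτ _).trans_lt hri
  have hstep := ht (Nat.pair i s)
  rw [Nat.unpair_pair, if_pos ⟨hs', hr'⟩] at hstep
  have := htτ (Nat.pair i s + 1)
  rw [hstep] at this
  exact absurd this (not_le.2 hri)

theorem absorb_limits {n : ℕ → ℕ} {a b : ℝ} (ha : 0 ≤ a) (hab : a ≤ b) (hb : b ≤ 1)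
    (h : ∀ x : ℝ, 0 ≤ x → x ≤ 1 →
      ((∃ i, leftEnd (n i) < x ∧ x < rightEnd (n i)) ↔ x < a ∨ b < x))
    {z : ℕ → ℚ × ℚ} (h0 : z 0 = (0, 1)) (hz : ∀ s, z (s + 1) = absorb (n s.unpair.1) (z s)) :
    ((∀ s, 0 ≤ (z s).1 ∧ ((z s).1 : ℝ) ≤ a) ∧ ∀ x < a, ∃ s, x < (z s).1) ∧
      (∀ s, (z s).2 ≤ 1 ∧ b ≤ (z s).2) ∧ ∀ x, b < x → ∃ s, ((z s).2 : ℝ) < x := by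
  constructor
  · exact absorb_limit (t := fun s => (z s).1) ha hab hb h (by simp [h0])
      fun s => by simp only [hz, absorb]
  -- The right endpoint is the left one after the reflection `x ↦ 1 - x`.
  · have key := absorb_limit (l := fun i => 1 - rightEnd (n i)) (r := fun i => 1 - leftEnd (n i))
      (a := 1 - b) (b := 1 - a) (t := fun s => 1 - (z s).2) (by linarith) (by linarith)
      (by linarith) (fun x h0 h1 => ?_) (by simp [h0]) (fun s => ?_)
    · refine ⟨fun s => ⟨?_, ?_⟩, fun x hx => ?_⟩
      · have := (key.1 s).1
        linarith
      · have := (key.1 s).2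
        push_cast at this
        linarith
      · obtain ⟨s, hs⟩ := key.2 (1 - x) (by linarith)
        push_cast at hs
        exact ⟨s, by linarith⟩
    · have := h (1 - x) (by linarith) (by linarith)
      push_cast
      rw [show x < 1 - b ↔ b < 1 - x by constructor <;> intro <;> linarith,
        show 1 - a < x ↔ 1 - x < a by constructor <;> intro <;> linarith, or_comm, ← this]
      refine exists_congr fun i => ?_
      constructor <;> rintro ⟨h1, h2⟩ <;> constructor <;> linarith
    · simp only [hz, absorb, sub_lt_sub_iff_left]
      split_ifs with h1 h2 h2 <;> first | rfl | tauto

/-! #### A function that vanishes on an interval given by outer approximations -/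

/-- The function that vanishes on `[t, u]` and has slope `1` outside. -/
def deadZone {𝕜 : Type*} [Field 𝕜] [LinearOrder 𝕜] (t u y : 𝕜) : 𝕜 := max 0 (y - u) - max 0 (t - y)

theorem cast_deadZone (t u y : ℚ) : ((deadZone t u y : ℚ) : ℝ) = deadZone (t : ℝ) u y := by
  simp [deadZone]

/-- The range `[-1, 2]` is that of `3 x - 1` on `[0, 1]`. The bound is uniform in `t` and `u`, which
gives a geometric majorant for the series. -/
theorem abs_deadZone_le {t u y : ℝ} (ht : t ≤ 1) (hu : 0 ≤ u) (hy0 : -1 ≤ y)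
    (hy1 : y ≤ 2) : |deadZone t u y| ≤ 2 := by
  have h1 : max 0 (y - u) ≤ 2 := max_le (by norm_num) (by linarith)
  have h2 : max 0 (t - y) ≤ 2 := max_le (by norm_num) (by linarith)
  exact abs_le.2 ⟨by unfold deadZone; linarith [le_max_left 0 (y - u)],
    by unfold deadZone; linarith [le_max_left 0 (t - y)]⟩

theorem abs_deadZone_sub_le (t u y y' : ℝ) :
    |deadZone t u y - deadZone t u y'| ≤ 2 * |y - y'| := by
  have h1 := abs_max_sub_max_le_abs (y - u) (y' - u) 0
  have h2 := abs_max_sub_max_le_abs (t - y) (t - y') 0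
  rw [show y - u - (y' - u) = y - y' by ring, max_comm _ 0, max_comm _ 0] at h1
  rw [show t - y - (t - y') = -(y - y') by ring, abs_neg, max_comm _ 0, max_comm _ 0] at h2
  have h3 := abs_sub (max 0 (y - u) - max 0 (y' - u)) (max 0 (t - y) - max 0 (t - y'))
  unfold deadZone
  rw [show max 0 (y - u) - max 0 (t - y) - (max 0 (y' - u) - max 0 (t - y')) =
    max 0 (y - u) - max 0 (y' - u) - (max 0 (t - y) - max 0 (t - y')) by ring]
  linarith

section Series

variable {t u : ℕ → ℝ}

/-- The weighted sum of the functions `deadZone (t s) (u s)`. -/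
noncomputable def deadZoneSum (t u : ℕ → ℝ) (y : ℝ) : ℝ :=
  ∑' s, (1 / 2 : ℝ) ^ s * deadZone (t s) (u s) y

theorem hasSum_half_pow (c : ℝ) : HasSum (fun s : ℕ => c * (1 / 2 : ℝ) ^ s) (2 * c) := by
  rw [mul_comm 2 c]
  exact hasSum_geometric_two.mul_left c

theorem norm_half_pow_mul_deadZone_le (ht : ∀ s, t s ≤ 1) (hu : ∀ s, 0 ≤ u s) {y : ℝ}
    (hy : y ∈ Set.Icc (-1 : ℝ) 2) (s : ℕ) :
    ‖(1 / 2 : ℝ) ^ s * deadZone (t s) (u s) y‖ ≤ 2 * (1 / 2 : ℝ) ^ s := by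
  rw [norm_mul, mul_comm, Real.norm_eq_abs, Real.norm_of_nonneg (by positivity)]
  gcongr
  exact abs_deadZone_le (ht s) (hu s) hy.1 hy.2

theorem summable_deadZone (ht : ∀ s, t s ≤ 1) (hu : ∀ s, 0 ≤ u s) {y : ℝ}
    (hy : y ∈ Set.Icc (-1 : ℝ) 2) : Summable fun s => (1 / 2 : ℝ) ^ s * deadZone (t s) (u s) y :=
  Summable.of_norm_bounded (hasSum_half_pow 2).summable (norm_half_pow_mul_deadZone_le ht hu hy)

/-- The tail is dominated by `∑_{s ≥ n} 2 · 2⁻ˢ = 4 · 2⁻ⁿ`. -/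
theorem abs_deadZoneSum_sub_sum_le (ht : ∀ s, t s ≤ 1) (hu : ∀ s, 0 ≤ u s) {y : ℝ}
    (hy : y ∈ Set.Icc (-1 : ℝ) 2) (n : ℕ) :
    |deadZoneSum t u y - ∑ s ∈ Finset.range n, (1 / 2 : ℝ) ^ s * deadZone (t s) (u s) y| ≤
      4 * (1 / 2 : ℝ) ^ n := by
  rw [deadZoneSum, ← (summable_deadZone ht hu hy).sum_add_tsum_nat_add n, add_sub_cancel_left,
    ← Real.norm_eq_abs, show 4 * (1 / 2 : ℝ) ^ n = 2 * (2 * (1 / 2 : ℝ) ^ n) by ring]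
  refine tsum_of_norm_bounded (hasSum_half_pow (2 * (1 / 2 : ℝ) ^ n)) fun s => ?_
  refine (norm_half_pow_mul_deadZone_le ht hu hy _).trans_eq ?_
  rw [pow_add]
  ring

theorem abs_deadZoneSum_sub_le (ht : ∀ s, t s ≤ 1) (hu : ∀ s, 0 ≤ u s) {y y' : ℝ}
    (hy : y ∈ Set.Icc (-1 : ℝ) 2) (hy' : y' ∈ Set.Icc (-1 : ℝ) 2) :
    |deadZoneSum t u y - deadZoneSum t u y'| ≤ 4 * |y - y'| := by
  rw [deadZoneSum, deadZoneSum,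
    ← (summable_deadZone ht hu hy).tsum_sub (summable_deadZone ht hu hy'),
    ← Real.norm_eq_abs, show 4 * |y - y'| = 2 * (2 * |y - y'|) by ring]
  refine tsum_of_norm_bounded (hasSum_half_pow (2 * |y - y'|)) fun s => ?_
  rw [← mul_sub, norm_mul, mul_comm, Real.norm_eq_abs, Real.norm_of_nonneg (by positivity)]
  gcongr
  exact abs_deadZone_sub_le _ _ _ _

/-- To the left of all `u s` only the nonpositive parts remain, so no term can cancel the one that
is strictly negative. -/
theorem deadZoneSum_neg (ht : ∀ s, t s ≤ 1) (hu : ∀ s, 0 ≤ u s) {y : ℝ}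
    (hy : y ∈ Set.Icc (-1 : ℝ) 2) (hyu : ∀ s, y ≤ u s) (hyt : ∃ s, y < t s) :
    deadZoneSum t u y < 0 := by
  have hval : ∀ s, deadZone (t s) (u s) y = -max 0 (t s - y) := fun s => by
    rw [deadZone, max_eq_left (sub_nonpos.2 (hyu s)), zero_sub]
  obtain ⟨s, hs⟩ := hyt
  rw [← neg_pos, deadZoneSum, ← tsum_neg]
  refine (summable_deadZone ht hu hy).neg.tsum_pos (fun i => ?_) s ?_
  · rw [hval, mul_neg, neg_neg]
    positivity
  · rw [hval, mul_neg, neg_neg]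
    have : 0 < max 0 (t s - y) := lt_max_of_lt_right (sub_pos.2 hs)
    positivity

theorem deadZoneSum_pos (ht : ∀ s, t s ≤ 1) (hu : ∀ s, 0 ≤ u s) {y : ℝ}
    (hy : y ∈ Set.Icc (-1 : ℝ) 2) (hyt : ∀ s, t s ≤ y) (hyu : ∃ s, u s < y) :
    0 < deadZoneSum t u y := by
  have hval : ∀ s, deadZone (t s) (u s) y = max 0 (y - u s) := fun s => by
    rw [deadZone, max_eq_left (sub_nonpos.2 (hyt s)), sub_zero]
  obtain ⟨s, hs⟩ := hyu
  refine (summable_deadZone ht hu hy).tsum_pos (fun i => ?_) s ?_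
  · rw [hval]
    positivity
  · rw [hval]
    have : 0 < max 0 (y - u s) := lt_max_of_lt_right (sub_pos.2 hs)
    positivity

end Series

/-! #### Names of the function -/

/-- Halving the tolerance pays for the triangle inequality: `2⁻⁽ⁱ⁺¹⁾ + 2⁻⁽ᵏ⁺¹⁾ ≤ 2⁻ⁱ`. -/
theorem isName_cauchyRep_of_dist_le {X : Type*} [MetricSpace X] {α : ℕ → X} (hα : DenseRange α)
    {p : Baire} {x : X} (h : ∀ k, dist x (α (p k)) ≤ (1 / 2 : ℝ) ^ (k + 1)) :
    (cauchyRep α hα).IsName p x := by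
  refine ⟨fun i k hik => ?_, ?_⟩
  · have h1 := dist_triangle_left (α (p i)) (α (p k)) x
    have h2 : (1 / 2 : ℝ) ^ (k + 1) ≤ (1 / 2 : ℝ) ^ (i + 1) :=
      pow_le_pow_of_le_one (by norm_num) (by norm_num) (by omega)
    have h3 : (1 / 2 : ℝ) ^ (i + 1) + (1 / 2 : ℝ) ^ (i + 1) = (1 / 2 : ℝ) ^ i := by ring
    linarith [h i, h k]
  · rw [tendsto_iff_dist_tendsto_zero]
    refine squeeze_zero (fun _ => dist_nonneg) (g := fun n => (1 / 2 : ℝ) ^ n) (fun n => ?_)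
      (tendsto_pow_atTop_nhds_zero_of_lt_one (by norm_num) (by norm_num))
    rw [dist_comm]
    exact (h n).trans (pow_le_pow_of_le_one (by norm_num) (by norm_num) (by omega))

/-- The hat functions form a partition of unity (`hat_sum`), so the polygon averages the node
values, with nonzero weight only at nodes less than one mesh width from `x`. -/
theorem dist_polygon_le {f : C(unitInterval, ℝ)} {m : ℕ} {y : ℕ → ℝ} {ε : ℝ} (hε : 0 ≤ ε)
    (h : ∀ i ≤ m + 1, ∀ x : unitInterval,
      |(x : ℝ) - (i : ℝ) / (m + 1)| ≤ 1 / ((m : ℝ) + 1) → |f x - y i| ≤ ε) :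
    dist f (polygon m y) ≤ ε := by
  refine (ContinuousMap.dist_le hε).2 fun x => ?_
  have hm0 : (0 : ℝ) < m + 1 := by positivity
  have hs := hat_sum m (((m : ℝ) + 1) * x) (mul_nonneg hm0.le x.2.1)
    (mul_le_of_le_one_right hm0.le x.2.2)
  have hfx : f x = ∑ i ∈ Finset.range (m + 2),
      f x * max 0 (1 - |((m : ℝ) + 1) * (x : ℝ) - i|) := by
    rw [← Finset.mul_sum, hs, mul_one]
  have hε' : ε = ∑ i ∈ Finset.range (m + 2),
      ε * max 0 (1 - |((m : ℝ) + 1) * (x : ℝ) - i|) := by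
    rw [← Finset.mul_sum, hs, mul_one]
  have hpx : polygon m y x = ∑ i ∈ Finset.range (m + 2),
      y i * max 0 (1 - |((m : ℝ) + 1) * (x : ℝ) - i|) := rfl
  rw [hpx, hfx, Real.dist_eq, ← Finset.sum_sub_distrib, hε']
  refine (Finset.abs_sum_le_sum_abs _ _).trans (Finset.sum_le_sum fun i hi => ?_)
  rw [← sub_mul, abs_mul, abs_of_nonneg (le_max_left (0 : ℝ) _)]
  rcases le_total (1 : ℝ) |((m : ℝ) + 1) * (x : ℝ) - i| with h1 | h1
  · rw [max_eq_left (by linarith), mul_zero, mul_zero]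
  · exact mul_le_mul_of_nonneg_right
      (h i (Nat.lt_succ_iff.1 (Finset.mem_range.1 hi)) x (node_dist m i x h1)) (le_max_left _ _)

/-- The partial sums of `deadZoneSum` at the nodes of a polygon, as a function of the precision `k`,
of the list of outer approximations, and of the node `i / 2 ^ (k + 6)`. -/
def nodeValue (k : ℕ) (l : List (ℕ × ℕ)) (i : ℕ) : ℚ :=
  ∑ s ∈ Finset.range (k + 4), (1 / 2) ^ s *
    deadZone (ratNum (l.getD s (0, 0)).1) (ratNum (l.getD s (0, 0)).2)
      (3 * (i * (1 / 2) ^ (k + 6)) - 1)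

theorem ratPrimrec_nodeValue :
    RatPrimrec fun y : (ℕ × List (ℕ × ℕ)) × ℕ => nodeValue y.1.1 y.1.2 y.2 := by
  have hk : Primrec fun y : ((ℕ × List (ℕ × ℕ)) × ℕ) × ℕ => y.1.1.1 :=
    Primrec.fst.comp (Primrec.fst.comp Primrec.fst)
  have hi : Primrec fun y : ((ℕ × List (ℕ × ℕ)) × ℕ) × ℕ => y.1.2 :=
    Primrec.snd.comp Primrec.fst
  have hz : Primrec fun y : ((ℕ × List (ℕ × ℕ)) × ℕ) × ℕ => y.1.1.2.getD y.2 (0, 0) :=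
    (Primrec.list_getD (0, 0)).comp (Primrec.snd.comp (Primrec.fst.comp Primrec.fst)) Primrec.snd
  have ht := RatPrimrec.ratNum (Primrec.fst.comp hz)
  have hu := RatPrimrec.ratNum (Primrec.snd.comp hz)
  have hy := ((RatPrimrec.const 3).mul ((RatPrimrec.natCast hi).mul (RatPrimrec.half_pow
    (Primrec.nat_add.comp hk (Primrec.const 6))))).sub (RatPrimrec.const 1)
  exact RatPrimrec.sum_range
    (Primrec.nat_add.comp (Primrec.fst.comp Primrec.fst) (Primrec.const 4))
    ((RatPrimrec.half_pow Primrec.snd).mul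
      (((RatPrimrec.const 0).max (hy.sub hu)).sub ((RatPrimrec.const 0).max (ht.sub hy))))

theorem exists_primrec_polygon : ∃ g : ℕ → List (ℕ × ℕ) → ℕ, Primrec₂ g ∧ ∀ k l, ∃ v : ℕ → ℝ,
    polygonNum (g k l) = polygon (2 ^ (k + 6) - 1) v ∧
      ∀ i ≤ 2 ^ (k + 6), v i = nodeValue k l i := by
  obtain ⟨w, hw, hw'⟩ := ratPrimrec_nodeValue
  have hpow : Primrec fun y : ℕ × List (ℕ × ℕ) => 2 ^ (y.1 + 6) :=
    primrec_two_pow.comp (Primrec.nat_add.comp Primrec.fst (Primrec.const 6))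
  -- `polygon m` has `m + 1` pieces and `m + 2` nodes; hence `m = 2 ^ (k + 6) - 1` and a list of `2
  -- ^ (k + 6) + 1` values.
  refine ⟨fun k l => Nat.pair (2 ^ (k + 6) - 1)
      (encode ((List.range (2 ^ (k + 6) + 1)).map fun i => w ((k, l), i))),
    (Primrec₂.natPair.comp (Primrec.nat_sub.comp hpow (Primrec.const 1))
      (Primrec.encode.comp (Primrec.list_map (Primrec.list_range.comp (Primrec.succ.comp hpow))
        hw.to₂))).to₂, fun k l => ⟨_, by rw [polygonNum, Nat.unpair_pair], fun i hi => ?_⟩⟩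
  have hi' : i < 2 ^ (k + 6) + 1 := Nat.lt_succ_of_le hi
  simp only [Denumerable.ofNat_encode, List.getD, List.getElem?_map,
    List.getElem?_range hi', Option.map_some, Option.getD_some, hw']

theorem cast_nodeValue {k : ℕ} {z : ℕ → ℕ × ℕ} {i : ℕ} :
    (nodeValue k ((List.range (k + 4)).map z) i : ℝ) =
      ∑ s ∈ Finset.range (k + 4), (1 / 2 : ℝ) ^ s * deadZone (ratNum (z s).1 : ℝ)
        (ratNum (z s).2) (3 * (i * (1 / 2) ^ (k + 6)) - 1) := by
  rw [nodeValue, Rat.cast_sum]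
  refine Finset.sum_congr rfl fun s hs => ?_
  simp only [List.getD, List.getElem?_map, List.getElem?_range (Finset.mem_range.1 hs),
    Option.map_some, Option.getD_some]
  rw [Rat.cast_mul, cast_deadZone]
  push_cast
  rfl

theorem three_mul_sub_one_mem {x : ℝ} (h0 : 0 ≤ x) (h1 : x ≤ 1) :
    3 * x - 1 ∈ Set.Icc (-1 : ℝ) 2 :=
  ⟨by linarith, by linarith⟩

/-- A name of an interval can be converted into a name of a function with a sign change whose zero
set is the interval, shrunk to a third and shifted by a third. -/
theorem exists_totalRec_sign_change : ∃ K : Baire → ℕ → ℕ, TotalRec K ∧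
    ∀ (p : Baire) (A : TopologicalSpace.Closeds unitInterval), RepresentedSpace.IsName p A →
      A ∈ intervalChoice.dom → ∃ f : C(unitInterval, ℝ), f 0 * f 1 < 0 ∧
        RepresentedSpace.IsName (K p) f ∧
        ∀ x, f x = 0 → Set.projIcc 0 1 zero_le_one (3 * (x : ℝ) - 1) ∈ A := by
  obtain ⟨g, hg, hpoly⟩ := exists_primrec_polygon
  obtain ⟨z, hz, hz'⟩ := exists_totalRec_absorb
  refine ⟨fun p k => g k ((List.range (k + 4)).map (z p)),
    TotalRec.primrec_comp hg ((TotalRec.of_primrec Primrec.id).pair (hz.listMap.comp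
      (TotalRec.of_primrec (Primrec.nat_add.comp Primrec.id (Primrec.const 4))))),
    fun p A hp hA => ?_⟩
  obtain ⟨a, b, hab, hA⟩ := hA
  have hab' : (a : ℝ) ≤ b := hab
  rw [isName_closeds_iff] at hp
  have hmem : ∀ x : unitInterval, x ∈ A ↔ (a : ℝ) ≤ x ∧ (x : ℝ) ≤ b := fun x => by
    rw [← SetLike.mem_coe, hA]
    rfl
  have hcover : ∀ x : ℝ, 0 ≤ x → x ≤ 1 →
      ((∃ i, leftEnd (p i) < x ∧ x < rightEnd (p i)) ↔ x < a ∨ b < x) := by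
    intro x h0 h1
    have h := Set.ext_iff.1 hp ⟨x, h0, h1⟩
    rw [Set.mem_iUnion, Set.mem_compl_iff, SetLike.mem_coe, hmem, not_and_or, not_le, not_le] at h
    rw [h]
    exact exists_congr fun i => (mem_ratBall_unitNum (x := ⟨x, h0, h1⟩)).symm
  obtain ⟨⟨hta, hta'⟩, hub, hub'⟩ := absorb_limits (n := p)
    (z := fun s => Prod.map ratNum ratNum (z p s)) a.2.1 hab' b.2.2 hcover (hz' p).1 (hz' p).2
  simp only [Prod.map_fst, Prod.map_snd] at hta hta' hub hub'
  set t : ℕ → ℝ := fun s => ratNum (z p s).1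
  set u : ℕ → ℝ := fun s => ratNum (z p s).2
  have ht0 : ∀ s, 0 ≤ t s := fun s => Rat.cast_nonneg.2 (hta s).1
  have ht : ∀ s, t s ≤ 1 := fun s => (hta s).2.trans a.2.2
  have hu : ∀ s, 0 ≤ u s := fun s => b.2.1.trans (hub s).2
  have hu1 : ∀ s, u s ≤ 1 := fun s => (Rat.cast_le.2 (hub s).1).trans_eq Rat.cast_one
  have hlip : ∀ x y : ℝ, 0 ≤ x → x ≤ 1 → 0 ≤ y → y ≤ 1 →
      |deadZoneSum t u (3 * x - 1) - deadZoneSum t u (3 * y - 1)| ≤ 12 * |x - y| := by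
    intro x y hx0 hx1 hy0 hy1
    refine (abs_deadZoneSum_sub_le ht hu (three_mul_sub_one_mem hx0 hx1)
      (three_mul_sub_one_mem hy0 hy1)).trans_eq ?_
    rw [show 3 * x - 1 - (3 * y - 1) = 3 * (x - y) by ring, abs_mul, abs_of_pos three_pos]
    ring
  have hcont : Continuous fun x : unitInterval => deadZoneSum t u (3 * (x : ℝ) - 1) :=
    (LipschitzWith.of_dist_le_mul (K := 12) fun x y => by
      rw [Real.dist_eq, Subtype.dist_eq, Real.dist_eq]
      exact hlip x y x.2.1 x.2.2 y.2.1 y.2.2).continuous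
  refine ⟨⟨_, hcont⟩, ?_, ?_, fun x hx => ?_⟩
  -- At `x = 0` the argument is `-1 < 0 ≤ t 0`, and at `x = 1` it is `2 > 1 ≥ u 0`, so a single
  -- stage already makes both signs strict.
  · refine mul_neg_of_neg_of_pos (deadZoneSum_neg ht hu ?_ (fun s => ?_) ⟨0, ?_⟩)
      (deadZoneSum_pos ht hu ?_ (fun s => ?_) ⟨0, ?_⟩)
    · exact three_mul_sub_one_mem le_rfl zero_le_one
    · have := hu s
      simp only [Set.Icc.coe_zero]
      linarith
    · have := ht0 0
      simp only [Set.Icc.coe_zero]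
      linarith
    · exact three_mul_sub_one_mem zero_le_one le_rfl
    · have := ht s
      simp only [Set.Icc.coe_one]
      linarith
    · have := hu1 0
      simp only [Set.Icc.coe_one]
      linarith
  · refine isName_cauchyRep_of_dist_le polygonNum_dense fun k => ?_
    obtain ⟨v, hv, hv'⟩ := hpoly k ((List.range (k + 4)).map (z p))
    rw [hv]
    have hm : 2 ^ (k + 6) - 1 + 1 = 2 ^ (k + 6) := Nat.sub_add_cancel Nat.one_le_two_pow
    have hmR : (((2 ^ (k + 6) - 1 : ℕ) : ℝ) + 1) = 2 ^ (k + 6) := by exact_mod_cast hm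
    refine dist_polygon_le (by positivity) fun i hi x hx => ?_
    rw [hm] at hi
    rw [hmR, div_eq_mul_one_div, ← one_div_pow] at hx
    have hi0 : 0 ≤ (i : ℝ) * (1 / 2) ^ (k + 6) := by positivity
    have hi1 : (i : ℝ) * (1 / 2) ^ (k + 6) ≤ 1 := by
      rw [one_div_pow, mul_one_div, div_le_one (by positivity)]
      exact_mod_cast hi
    rw [hv' i hi, cast_nodeValue, ContinuousMap.coe_mk]
    have h1 := hlip x _ x.2.1 x.2.2 hi0 hi1
    have h2 := abs_deadZoneSum_sub_sum_le ht hu (three_mul_sub_one_mem hi0 hi1) (k + 4)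
    have h3 := abs_sub_le (deadZoneSum t u (3 * (x : ℝ) - 1))
      (deadZoneSum t u (3 * ((i : ℝ) * (1 / 2) ^ (k + 6)) - 1))
      (∑ s ∈ Finset.range (k + 4), (1 / 2 : ℝ) ^ s * deadZone (t s) (u s)
        (3 * ((i : ℝ) * (1 / 2) ^ (k + 6)) - 1))
    have h4 : (1 / 2 : ℝ) ^ (k + 6) = (1 / 64) * (1 / 2) ^ k := by ring
    have h5 : (1 / 2 : ℝ) ^ (k + 4) = (1 / 16) * (1 / 2) ^ k := by ring
    have h6 : (1 / 2 : ℝ) ^ (k + 1) = (1 / 2) * (1 / 2) ^ k := by ring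
    have h7 : (0 : ℝ) < (1 / 2) ^ k := by positivity
    refine h3.trans ?_
    linarith
  · have hx' : deadZoneSum t u (3 * (x : ℝ) - 1) = 0 := hx
    have hy := three_mul_sub_one_mem x.2.1 x.2.2
    -- Left of `a` some `t s` has passed the point, so the function is strictly negative there; the
    -- other side is symmetric.
    have hay : (a : ℝ) ≤ 3 * x - 1 := by
      by_contra! hlt
      exact (deadZoneSum_neg ht hu hy (fun s => (hlt.le.trans hab').trans (hub s).2)
        (hta' _ hlt)).ne hx'
    have hyb : 3 * (x : ℝ) - 1 ≤ b := by
      by_contra! hlt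
      exact (deadZoneSum_pos ht hu hy (fun s => (hta s).2.trans (hab'.trans hlt.le))
        (hub' _ hlt)).ne' hx'
    rw [Set.projIcc_of_mem _ ⟨a.2.1.trans hay, hyb.trans b.2.2⟩, hmem]
    exact ⟨hay, hyb⟩

/-- The map `x ↦ 3 x - 1`, clamped to `[0, 1]`, is computable. -/
theorem exists_totalRec_triple : ∃ H : Baire → ℕ → ℕ, TotalRec H ∧
    ∀ (q : Baire) (x : unitInterval), RepresentedSpace.IsName q x →
      RepresentedSpace.IsName (H q) (Set.projIcc (0 : ℝ) 1 zero_le_one (3 * (x : ℝ) - 1)) := by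
  obtain ⟨g, hg, hg'⟩ := ((RatPrimrec.const 3).mul RatPrimrec.clamp).sub (RatPrimrec.const 1)
  have hval : ∀ n, unitNum (g n) = Set.projIcc 0 1 zero_le_one (3 * (unitNum n : ℝ) - 1) := by
    intro n
    rw [coe_unitNum, unitNum, hg']
    push_cast
    rfl
  -- The map is 3-Lipschitz, and skipping two entries gains a factor 4.
  refine ⟨fun q n => g (q (n + 2)), TotalRec.primrec_comp hg
    (TotalRec.oracle.comp (TotalRec.of_primrec (Primrec.nat_add.comp Primrec.id
      (Primrec.const 2)))), fun q x hq => ⟨fun i k hik => ?_, ?_⟩⟩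
  · simp only [hval]
    rw [Subtype.dist_eq, Real.dist_eq]
    refine (Set.abs_projIcc_sub_projIcc _).trans ?_
    rw [sub_sub_sub_cancel_right, ← mul_sub, abs_mul, abs_of_pos three_pos]
    have h := hq.1 (i + 2) (k + 2) (by omega)
    rw [Subtype.dist_eq, Real.dist_eq, pow_add] at h
    have : (0 : ℝ) < (1 / 2) ^ i := by positivity
    linarith
  · simp only [hval]
    have hc : Continuous fun y : unitInterval =>
        Set.projIcc (0 : ℝ) 1 zero_le_one (3 * (y : ℝ) - 1) := by fun_prop
    exact (hc.tendsto x).comp (hq.2.comp (tendsto_add_atTop_nat 2))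

/-- The decoding map is the same for all intervals and sees only the zero, which makes the reduction
strong. -/
theorem intervalChoice_strongReducible_ivt : StrongReducible intervalChoice IVT := by
  obtain ⟨K, hK, hK'⟩ := exists_totalRec_sign_change
  obtain ⟨H, hH, hH'⟩ := exists_totalRec_triple
  refine ⟨_, _, hH.isComputable, hK.isComputable, fun G hG => ⟨_, fun p A hp hA => ?_, rfl⟩⟩
  obtain ⟨f, hf, hname, hzero⟩ := hK' p A hp hA
  obtain ⟨q, hq, x, hx, hqx⟩ := hG _ f hname hf
  exact ⟨H q, Part.mem_bind (Part.mem_bind (Part.mem_some _) hq) (Part.mem_some _),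
    _, hzero x hx, hH' q x hqx⟩

end Weihrauch

theorem mainTheorem4 :
    Weihrauch.StrongEquivalent Weihrauch.IVT Weihrauch.intervalChoice :=
  ⟨Weihrauch.ivt_strongReducible_intervalChoice, Weihrauch.intervalChoice_strongReducible_ivt⟩
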